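/- Let $\mathcal H_1,\mathcal H_2$ be real Hilbert spaces and $n\ge 2$. Assume: $C:\mathcal H_1\to\mathcal H_2$ is bounded and linear; for $i=2,\dots,n-1$, $f_i:\mathcal H_1\to\mathbb R$ is convex and differentiable with $\alpha$-Lipschitz gradient and $g_i:\mathcal H_2\to(-\infty,+\infty]$ is proper, closed and $\tau$-strongly convex; $f_n:\mathcal H_1\to(-\infty,+\infty]$ is proper, closed and $\sigma$-strongly convex; $g_n:\mathcal H_2\to\mathbb R$ is convex and differentiable with $\beta$-Lipschitz gradient ($\alpha,\beta\ge 0$, $\sigma,\tau>0$). Consider the primal problem $$\min_{u\in\mathcal H_1}\ \sum_{i=2}^n f_i(u)+(g_2\Box\cdots\Box g_n)(Cu)$$ and its Fenchel dual, in the form $$\min_{v\in\mathcal H_2}\ (f_2^*\Box\cdots\Box f_n^*)(-C^*v)+\sum_{i=2}^n g_i^*(v),$$ where $\Box$ is the infimal convolution and ${}^*$ denotes the Fenchel conjugate of a function and the adjoint of an operator. Let $\gamma\in(0,1)$, $(\mathbf p^0,\mathbf q^0)\in\mathcal H_1^{n-1}\times\mathcal H_2^{n-1}$, and for $k=0,1,2,\dots$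 let $$\begin{aligned} u_1^k&=(\mathrm{Id}+C^*C)^{-1}(p_1^k-C^*q_1^k), & v_1^k&=q_1^k+Cu_1^k,\\ u_i^k&=\mathrm{prox}_{f_i}(p_i^k+u_{i-1}^k-p_{i-1}^k), & v_i^k&=(\mathrm{Id}-\mathrm{prox}_{g_i})(q_i^k+v_{i-1}^k-q_{i-1}^k)\quad(2\le i\le n-1),\\ u_n^k&=\mathrm{prox}_{f_n}(u_1^k+u_{n-1}^k-p_{n-1}^k), & v_n^k&=(\mathrm{Id}-\mathrm{prox}_{g_n})(v_1^k+v_{n-1}^k-q_{n-1}^k),\\ p_i^{k+1}&=p_i^k+\gamma(u_{i+1}^k-u_i^k), & q_i^{k+1}&=q_i^k+\gamma(v_{i+1}^k-v_i^k)\quad(1\le i\le n-1). \end{aligned}$$ Let $A_1(u,v)=(C^*v,-Cu)$, $A_i(u,v)=(\nabla f_i(u),\nabla g_i^*(v))$ for $2\le i\le n-1$ and $A_n(u,v)=\partial f_n(u)\times\partial g_n^*(v)$ on $\mathcal H_1\times\mathcal H_2$, with resolvents $J_{A_i}=(\mathrm{Id}+A_i)^{-1}$. For $(\mathbf p,\mathbf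 q)\in\mathcal H_1^{n-1}\times\mathcal H_2^{n-1}$ put $z_i=(p_i,q_i)$, $x_1=J_{A_1}(z_1)$, $x_i=J_{A_i}(z_i+x_{i-1}-z_{i-1})$ for $2\le i\le n-1$, $x_n=J_{A_n}(x_1+x_{n-1}-z_{n-1})$, and let $T_{\rm PD}(\mathbf p,\mathbf q)$ be the point with components $z_i+\gamma(x_{i+1}-x_i)$, $1\le i\le n-1$. A sequence $(z^k)$ converges $R$-linearly to $z$ if there are $c\ge0$ and $r\in[0,1)$ with $\|z^k-z\|\le cr^k$ for all $k\in\mathbb N$. Then: (i) $T_{\rm PD}$ has a unique fixed point $(\mathbf p^*,\mathbf q^*)$, and $(\mathbf p^k,\mathbf q^k)$ converges $R$-linearly to it. (ii) The primal problem has a unique solution $u^*$, and $\mathbf u^k=(u_1^k,\dots,u_n^k)$ converges $R$-linearly to $(u^*,\dots,u^*)$ in $\mathcal H_1^n$. (iii) The dual problem has a unique solution $v^*$, and $\mathbf v^k=(v_1^k,\dots,v_n^k)$ converges $R$-linearly to $(v^*,\dots,v^*)$ in $\mathcal H_2^n$. (iv) The values $G(u_n^k,v_n^k)$ are real and converge $R$-linearly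 to $0$, where $$G(u,v)=\Bigl(\sum_{i=2}^n f_i(u)+\langle Cu,v^*\rangle-\sum_{i=2}^n g_i^*(v^*)\Bigr)-\Bigl(\sum_{i=2}^n f_i(u^*)+\langle Cu^*,v\rangle-\sum_{i=2}^n g_i^*(v)\Bigr).$$ -/

import Mathlib

open scoped NNReal InnerProductSpace

namespace PrimalDual

noncomputable section

/-! ### Convex analysis of extended-real-valued functions on a real Hilbert space -/

section Convex

variable {H : Type*} [NormedAddCommGroup H] [InnerProductSpace ℝ H]

/-- `F` never takes the value `-∞` and is not identically `+∞`. -/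
def Proper (F : H → EReal) : Prop :=
  (∀ x, F x ≠ ⊥) ∧ ∃ x, F x < ⊤

/-- Convexity of an extended-real-valued function. -/
def Convex (F : H → EReal) : Prop :=
  ∀ x y : H, ∀ t : ℝ, 0 < t → t < 1 →
    F ((1 - t) • x + t • y) ≤ ((1 - t : ℝ) : EReal) * F x + (t : EReal) * F y

/-- `F` is `σ`-strongly convex: `F - (σ / 2) ‖·‖ ^ 2` is convex. -/
def StronglyConvex (σ : ℝ) (F : H → EReal) : Prop :=
  Convex fun x => F x - ((σ / 2 * ‖x‖ ^ 2 : ℝ) : EReal)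

/-- `F` is proper, closed (that is, lower semicontinuous) and `σ`-strongly convex. -/
structure ProperClosedStronglyConvex (σ : ℝ) (F : H → EReal) : Prop where
  proper : Proper F
  closed : LowerSemicontinuous F
  stronglyConvex : StronglyConvex σ F

/-- `F` is real-valued, convex and differentiable with `L`-Lipschitz continuous gradient. -/
def ConvexLipschitzGradient [CompleteSpace H] (L : ℝ≥0) (F : H → EReal) : Prop :=
  ∃ φ : H → ℝ, (∀ x, F x = (φ x : EReal)) ∧
    ConvexOn ℝ Set.univ φ ∧ Differentiable ℝ φ ∧ LipschitzWith L (gradient φ)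

/-- The Fenchel conjugate `F* (w) = sup_x (⟪x, w⟫ - F x)`. -/
def conj (F : H → EReal) (w : H) : EReal :=
  ⨆ x : H, ((⟪x, w⟫_ℝ : ℝ) : EReal) - F x

/-- The infimal convolution of a finite family of functions. -/
def infConv {ι : Type*} [Fintype ι] (F : ι → H → EReal) (x : H) : EReal :=
  ⨅ (w : ι → H) (_ : x = ∑ i, w i), ∑ i, F i (w i)

/-- The (convex) subdifferential, empty outside the domain of `F`. -/
def subdifferential (F : H → EReal) (x : H) : Set H :=
  {w | F x < ⊤ ∧ ∀ y, ((⟪y - x, w⟫_ℝ : ℝ) : EReal) + F x ≤ F y}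

/-- The gradient of an extended-real-valued function which is finite everywhere. -/
def grad [CompleteSpace H] (F : H → EReal) (x : H) : H :=
  gradient (fun y => (F y).toReal) x

/-- The proximal operator: `prox F x` is a minimizer of `w ↦ F w + ‖x - w‖ ^ 2 / 2`
(there is exactly one when `F` is proper, lower semicontinuous and convex). -/
def prox (F : H → EReal) (x : H) : H :=
  Classical.epsilon fun y : H => ∀ w : H,
    F y + ((1 / 2 * ‖x - y‖ ^ 2 : ℝ) : EReal) ≤ F w + ((1 / 2 * ‖x - w‖ ^ 2 : ℝ) : EReal)

/-- `x` is a solution of the problem of minimizing `F` over the whole space. -/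
def IsSolution (F : H → EReal) (x : H) : Prop :=
  ∀ y, F x ≤ F y

end Convex

/-- `R`-linear convergence of a sequence: `‖z k - z‖ ≤ c * r ^ k` with `0 ≤ c`, `0 ≤ r < 1`. -/
def ConvergesRLinearly {E : Type*} [NormedAddCommGroup E] (z : ℕ → E) (zstar : E) : Prop :=
  ∃ c r : ℝ, 0 ≤ c ∧ 0 ≤ r ∧ r < 1 ∧ ∀ k, ‖z k - zstar‖ ≤ c * r ^ k

/-! ### Resolvent splitting with minimal lifting -/

section Resolvent

variable {E : Type*} [AddCommGroup E] [Module ℝ E]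

/-- The resolvent `(Id + A)⁻¹` of a set-valued operator, as a function: `y = resolvent A x`
satisfies `x ∈ y + A y` (there is exactly one such `y` when `A` is maximally monotone). -/
def resolvent (A : E → Set E) (x : E) : E :=
  Classical.epsilon fun y : E => x - y ∈ A y

/-- The points `x_1, …, x_{n-1}` (with `n = m + 2`) computed from `z = (z_1, …, z_{n-1})`:
`x_1 = J_{A_1} z_1` and `x_i = J_{A_i} (z_i + x_{i-1} - z_{i-1})`.
Here `A₁ = A_1` and `A i = A_{i+2}` for `i : Fin m`; tuples are indexed from `0`. -/
def splittingHead {m : ℕ} (A₁ : E → Set E) (A : Fin m → E → Set E)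
    (z : Fin (m + 1) → E) : Fin (m + 1) → E :=
  Fin.induction (motive := fun _ => E) (resolvent A₁ (z 0))
    (fun i x => resolvent (A i) (z i.succ + x - z i.castSucc))

/-- All the points `x_1, …, x_n`; the last one is
`x_n = J_{A_n} (x_1 + x_{n-1} - z_{n-1})`. -/
def splittingPoint {m : ℕ} (A₁ : E → Set E) (A : Fin m → E → Set E) (Aₙ : E → Set E)
    (z : Fin (m + 1) → E) : Fin (m + 2) → E :=
  Fin.snoc (α := fun _ => E) (splittingHead A₁ A z)
    (resolvent Aₙ
      (splittingHead A₁ A z 0 + splittingHead A₁ A z (Fin.last m) - z (Fin.last m)))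

/-- The fixed point operator `z ↦ z + γ (x_2 - x_1, …, x_n - x_{n-1})`. -/
def splittingOperator {m : ℕ} (γ : ℝ) (A₁ : E → Set E) (A : Fin m → E → Set E)
    (Aₙ : E → Set E) (z : Fin (m + 1) → E) : Fin (m + 1) → E :=
  fun i => z i + γ • (splittingPoint A₁ A Aₙ z i.succ - splittingPoint A₁ A Aₙ z i.castSucc)

end Resolvent

/-! ### The primal-dual problem and algorithm

Throughout `n = m + 2`, and the families `(f_2, …, f_n)`, `(g_2, …, g_n)` are
`f : Fin (m + 1) → H₁ → EReal`, `g : Fin (m + 1) → H₂ → EReal`; the entries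
`f i.castSucc` for `i : Fin m` are `f_2, …, f_{n-1}` and `f (Fin.last m)` is `f_n`. -/

section Problem

variable {H₁ H₂ : Type*}
  [NormedAddCommGroup H₁] [InnerProductSpace ℝ H₁] [CompleteSpace H₁]
  [NormedAddCommGroup H₂] [InnerProductSpace ℝ H₂] [CompleteSpace H₂]
  {m : ℕ}

/-- The standing assumptions on the functions `f_i` and `g_i`. -/
structure StandingAssumption (α β : ℝ≥0) (σ τ : ℝ)
    (f : Fin (m + 1) → H₁ → EReal) (g : Fin (m + 1) → H₂ → EReal) : Prop where
  f_smooth : ∀ i : Fin m, ConvexLipschitzGradient α (f i.castSucc)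
  f_last : ProperClosedStronglyConvex σ (f (Fin.last m))
  g_strong : ∀ i : Fin m, ProperClosedStronglyConvex τ (g i.castSucc)
  g_last : ConvexLipschitzGradient β (g (Fin.last m))

/-- The primal objective `∑ f_i (u) + (g_2 □ ⋯ □ g_n) (C u)`. -/
def primalObjective (C : H₁ →L[ℝ] H₂)
    (f : Fin (m + 1) → H₁ → EReal) (g : Fin (m + 1) → H₂ → EReal) (u : H₁) : EReal :=
  ∑ i, f i u + infConv g (C u)

/-- The objective `(f_2* □ ⋯ □ f_n*) (-C* v) + ∑ g_i* (v)` of the (Fenchel) dual problem. -/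
def dualObjective (C : H₁ →L[ℝ] H₂)
    (f : Fin (m + 1) → H₁ → EReal) (g : Fin (m + 1) → H₂ → EReal) (v : H₂) : EReal :=
  infConv (fun i => conj (f i)) (-(ContinuousLinearMap.adjoint C v)) + ∑ i, conj (g i) v

/-- The primal-dual gap relative to a primal-dual pair `(ustar, vstar)`. Under the standing
assumptions no function below takes the value `-∞`; the value is a real number
exactly when all of the terms are finite. -/
def gap (C : H₁ →L[ℝ] H₂)
    (f : Fin (m + 1) → H₁ → EReal) (g : Fin (m + 1) → H₂ → EReal)
    (ustar : H₁) (vstar : H₂) (u : H₁) (v : H₂) : EReal :=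
  (∑ i, f i u + ((⟪C u, vstar⟫_ℝ : ℝ) : EReal) - ∑ i, conj (g i) vstar)
    - (∑ i, f i ustar + ((⟪C ustar, v⟫_ℝ : ℝ) : EReal) - ∑ i, conj (g i) v)

/-- The operator `A_1 (u, v) = (C* v, -C u)`. -/
def opFirst (C : H₁ →L[ℝ] H₂) (x : H₁ × H₂) : Set (H₁ × H₂) :=
  {(ContinuousLinearMap.adjoint C x.2, -C x.1)}

/-- The operators `A_i (u, v) = (∇ f_i (u), ∇ g_i* (v))` for `i = 2, …, n - 1`. -/
def opMiddle (f : Fin (m + 1) → H₁ → EReal) (g : Fin (m + 1) → H₂ → EReal)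
    (i : Fin m) (x : H₁ × H₂) : Set (H₁ × H₂) :=
  {(grad (f i.castSucc) x.1, grad (conj (g i.castSucc)) x.2)}

/-- The operator `A_n (u, v) = ∂ f_n (u) × ∂ g_n* (v)`. -/
def opLast (f : Fin (m + 1) → H₁ → EReal) (g : Fin (m + 1) → H₂ → EReal)
    (x : H₁ × H₂) : Set (H₁ × H₂) :=
  subdifferential (f (Fin.last m)) x.1 ×ˢ subdifferential (conj (g (Fin.last m))) x.2

/-- The primal-dual fixed point operator on `H₁ ^ (n - 1) × H₂ ^ (n - 1)`: the resolvent
splitting operator of `A_1, …, A_n` on `(H₁ × H₂) ^ (n - 1)`, with the components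
of the pairs collected in two tuples. -/
def fixedPointOperator (γ : ℝ) (C : H₁ →L[ℝ] H₂)
    (f : Fin (m + 1) → H₁ → EReal) (g : Fin (m + 1) → H₂ → EReal)
    (pq : (Fin (m + 1) → H₁) × (Fin (m + 1) → H₂)) :
    (Fin (m + 1) → H₁) × (Fin (m + 1) → H₂) :=
  let z : Fin (m + 1) → H₁ × H₂ :=
    splittingOperator γ (opFirst C) (opMiddle f g) (opLast f g) fun i => (pq.1 i, pq.2 i)
  (fun i => (z i).1, fun i => (z i).2)

/-- The sequences `p k, q k, u k, v k` are generated by the primal-dual algorithm with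
step parameter `γ`, from the starting point `(p 0, q 0)`. -/
structure IsGenerated (γ : ℝ) (C : H₁ →L[ℝ] H₂)
    (f : Fin (m + 1) → H₁ → EReal) (g : Fin (m + 1) → H₂ → EReal)
    (p : ℕ → Fin (m + 1) → H₁) (q : ℕ → Fin (m + 1) → H₂)
    (u : ℕ → Fin (m + 2) → H₁) (v : ℕ → Fin (m + 2) → H₂) : Prop where
  u_first : ∀ k, u k 0 =
    (ContinuousLinearMap.id ℝ H₁ + ContinuousLinearMap.adjoint C ∘L C).inverse (p k 0 - ContinuousLinearMap.adjoint C (q k 0))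
  v_first : ∀ k, v k 0 = q k 0 + C (u k 0)
  u_middle : ∀ k, ∀ i : Fin m, u k i.succ.castSucc =
    prox (f i.castSucc) (p k i.succ + u k i.castSucc.castSucc - p k i.castSucc)
  v_middle : ∀ k, ∀ i : Fin m, v k i.succ.castSucc =
    (q k i.succ + v k i.castSucc.castSucc - q k i.castSucc)
      - prox (g i.castSucc) (q k i.succ + v k i.castSucc.castSucc - q k i.castSucc)
  u_last : ∀ k, u k (Fin.last (m + 1)) =
    prox (f (Fin.last m)) (u k 0 + u k (Fin.last m).castSucc - p k (Fin.last m))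
  v_last : ∀ k, v k (Fin.last (m + 1)) =
    (v k 0 + v k (Fin.last m).castSucc - q k (Fin.last m))
      - prox (g (Fin.last m)) (v k 0 + v k (Fin.last m).castSucc - q k (Fin.last m))
  p_update : ∀ k, ∀ i : Fin (m + 1), p (k + 1) i = p k i + γ • (u k i.succ - u k i.castSucc)
  q_update : ∀ k, ∀ i : Fin (m + 1), q (k + 1) i = q k i + γ • (v k i.succ - v k i.castSucc)

end Problem

end

end PrimalDual

/-!
# `R`-linear convergence of the primal-dual splitting method

A step of the splitting method at `z` produces points `x_i` and values `a_i ∈ A_i (x_i)` tied to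
`z` by linear relations (`IsSplitting`). These relations are preserved under differences of two
steps, so it suffices to study one such triple `(z, x, a)`, where `z⁺ = z + γ (x_{i+1} - x_i)_i` is
the update. Expanding squares gives the energy identity (`IsSplitting.energy`)

`‖z⁺‖² = ‖z‖² - 2 γ ∑ ⟪x_i, a_i⟫ - γ (1 - γ) ∑ ‖x_{i+1} - x_i‖² - γ ‖x_1 - x_n‖²`.

If all operators are monotone and the last one is strongly monotone, the square norm drops at least
by a multiple of `Q = ‖x_n‖² + ∑ ‖x_{i+1} - x_i‖²`. This `Q` bounds all the `x_i`, and if the first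
`n - 1` operators are Lipschitz continuous it bounds `a_1, …, a_{n-1}` and hence `‖z‖²` as well.
So the update is a contraction in the Hilbert norm, and the `x_i`, `a_i` are Lipschitz functions
of `z` (`IsSplitting.exists_contraction`).

In the primal-dual case `A_1` is skew and bounded. A strongly convex `g_i` has a differentiable
conjugate with Lipschitz gradient (`IsClosedConvex.grad_conj`), and the conjugate of `g_n` is
strongly convex because `g_n` has a Lipschitz gradient
(`ConvexLipschitzGradient.subgradientGrowth_conj`). Thus the hypotheses hold on `H₁ × H₂`. Both the
algorithm and the fixed point operator consist of such steps, because proximal points exist and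
satisfy `p - prox F p ∈ ∂ F (prox F p)`; Moreau's decomposition appears as the fact that
`v = q - prox g q` satisfies `v ∈ ∂ g (q - v)`. Banach's theorem gives the fixed point, and the
comparison of the algorithm with the step at the fixed point gives linear convergence.

At the fixed point all `x_i` agree with one pair `(u, v)`, and `∑ a_i = 0` is the optimality system
`-C* v ∈ ∑ ∂ f_i (u)`, `C u ∈ ∑ ∂ g_i* (v)` (`IsKKTPoint`). Adding subgradient inequalities shows
that both objectives grow quadratically away from `u` and `v`, so these are the unique solutions,
and that the gap is between zero and a sum of products of two factors of the order of the error
(`IsKKTPoint.exists_gap_eq`).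
-/

namespace PrimalDual

/-! ### Epigraph form of strong convexity and existence of minimizers -/

theorem le_of_forall_real_upper_bound {a e : EReal} (h : ∀ b : ℝ, e ≤ b → a ≤ b) : a ≤ e :=
  EReal.le_of_forall_lt_iff_le.1 fun z hz => h z hz.le

theorem eq_coe_of_le {X : Type*} {F : X → EReal} (hF : ∀ x, F x ≠ ⊥) {x : X} {a : ℝ} (h : F x ≤ a) :
    ∃ c : ℝ, F x = c ∧ c ≤ a := by
  have h1 : F x ≠ ⊤ := (h.trans_lt (EReal.coe_lt_top a)).ne
  refine ⟨(F x).toReal, (EReal.coe_toReal h1 (hF x)).symm, ?_⟩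
  rw [← EReal.coe_toReal h1 (hF x)] at h
  exact_mod_cast h

theorem Proper.exists_coe {X : Type*} {F : X → EReal} (hF : Proper F) :
    ∃ (x : X) (c : ℝ), F x = c := by
  obtain ⟨x, hx⟩ := hF.2
  exact ⟨x, (F x).toReal, (EReal.coe_toReal hx.ne (hF.1 x)).symm⟩

section Epigraph

variable {H : Type*} [NormedAddCommGroup H] [InnerProductSpace ℝ H]

theorem norm_sq_convex_comb (x y : H) (t : ℝ) :
    ‖(1 - t) • x + t • y‖ ^ 2
      = (1 - t) * ‖x‖ ^ 2 + t * ‖y‖ ^ 2 - t * (1 - t) * ‖x - y‖ ^ 2 := by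
  rw [norm_add_sq_real, norm_sub_sq_real, inner_smul_left, inner_smul_right, norm_smul, norm_smul,
    mul_pow, mul_pow, Real.norm_eq_abs, Real.norm_eq_abs, sq_abs, sq_abs]
  simp only [conj_trivial]
  ring

/-- Strong convexity with modulus `σ` (plain convexity for `σ = 0`), expressed through real upper
bounds of the values, that is, through points of the epigraph. This avoids arithmetic with
infinite values. -/
def EpiConvex (σ : ℝ) (F : H → EReal) : Prop :=
  ∀ ⦃x y : H⦄ ⦃a b : ℝ⦄, F x ≤ a → F y ≤ b → ∀ ⦃t : ℝ⦄, 0 < t → t < 1 →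
    F ((1 - t) • x + t • y)
      ≤ (((1 - t) * a + t * b - σ / 2 * (t * (1 - t) * ‖x - y‖ ^ 2) : ℝ) : EReal)

/-- `F` is proper, lower semicontinuous and strongly convex with modulus `σ`, in the epigraph
form of strong convexity; `σ = 0` is allowed. -/
structure IsClosedConvex (σ : ℝ) (F : H → EReal) : Prop where
  proper : Proper F
  closed : LowerSemicontinuous F
  epi : EpiConvex σ F

theorem ProperClosedStronglyConvex.isClosedConvex {σ : ℝ} {F : H → EReal}
    (hF : ProperClosedStronglyConvex σ F) : IsClosedConvex σ F := by
  refine ⟨hF.proper, hF.closed, ?_⟩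
  intro x y a b ha hb t ht ht1
  obtain ⟨c, hc, hca⟩ := eq_coe_of_le hF.proper.1 ha
  obtain ⟨d, hd, hdb⟩ := eq_coe_of_le hF.proper.1 hb
  have h := hF.stronglyConvex x y t ht ht1
  simp only [hc, hd] at h
  have h2 : F ((1 - t) • x + t • y) ≤ (((1 - t) * (c - σ / 2 * ‖x‖ ^ 2) +
      t * (d - σ / 2 * ‖y‖ ^ 2) + σ / 2 * ‖(1 - t) • x + t • y‖ ^ 2 : ℝ) : EReal) := by
    rw [EReal.sub_le_iff_le_add (.inl (EReal.coe_ne_bot _)) (.inl (EReal.coe_ne_top _))] at h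
    exact_mod_cast h
  refine h2.trans ?_
  rw [norm_sq_convex_comb]
  norm_cast
  nlinarith [mul_le_mul_of_nonneg_left hca (sub_nonneg.2 ht1.le),
    mul_le_mul_of_nonneg_left hdb ht.le]

theorem IsClosedConvex.mono {σ σ' : ℝ} {F : H → EReal} (hF : IsClosedConvex σ F) (h : σ' ≤ σ) :
    IsClosedConvex σ' F := by
  refine ⟨hF.proper, hF.closed, fun x y a b ha hb t ht ht1 => (hF.epi ha hb ht ht1).trans ?_⟩
  norm_cast
  have : 0 ≤ t * (1 - t) * ‖x - y‖ ^ 2 := by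
    have := sub_pos.2 ht1
    positivity
  nlinarith

/-- Adding a continuous real-valued function that is strongly convex with modulus `κ` (written
in the form of an inequality) adds up the moduli. -/
theorem IsClosedConvex.add_coe {σ κ : ℝ} {F : H → EReal} (hF : IsClosedConvex σ F) {φ : H → ℝ}
    (hφ : Continuous φ)
    (hκ : ∀ x y t, 0 < t → t < 1 → φ ((1 - t) • x + t • y)
      ≤ (1 - t) * φ x + t * φ y - κ / 2 * (t * (1 - t) * ‖x - y‖ ^ 2)) :
    IsClosedConvex (σ + κ) fun x => F x + (φ x : EReal) := by
  refine ⟨⟨fun x => ?_, ?_⟩, ?_, ?_⟩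
  · simp [EReal.add_eq_bot_iff, hF.proper.1 x]
  · obtain ⟨x, hx⟩ := hF.proper.2
    exact ⟨x, EReal.add_lt_top hx.ne (EReal.coe_ne_top _)⟩
  · refine hF.closed.add' (continuous_coe_real_ereal.comp hφ).lowerSemicontinuous fun x => ?_
    exact EReal.continuousAt_add (.inr (EReal.coe_ne_bot _)) (.inr (EReal.coe_ne_top _))
  · intro x y a b ha hb t ht ht1
    have aux : ∀ {z : H} {e : ℝ}, F z + (φ z : EReal) ≤ e → F z ≤ ((e - φ z : ℝ) : EReal) := by
      intro z e h
      rw [EReal.coe_sub]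
      exact EReal.le_sub_iff_add_le (.inl (EReal.coe_ne_bot _)) (.inl (EReal.coe_ne_top _)) |>.2 h
    have h := hF.epi (aux ha) (aux hb) ht ht1
    refine (add_le_add_left h _).trans ?_
    norm_cast
    linarith [hκ x y t ht ht1]

/-- A point where the values are minimal satisfies the quadratic growth condition. -/
theorem EpiConvex.growth {σ : ℝ} {F : H → EReal} (hF : EpiConvex σ F) {x : H} {c : ℝ}
    (hx : F x = c) (hmin : ∀ y, (c : EReal) ≤ F y) (y : H) :
    ((c + σ / 2 * ‖y - x‖ ^ 2 : ℝ) : EReal) ≤ F y := by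
  refine le_of_forall_real_upper_bound fun b hb => ?_
  norm_cast
  have key : ∀ t : ℝ, 0 < t → t < 1 → c + σ / 2 * (1 - t) * ‖y - x‖ ^ 2 ≤ b := by
    intro t ht ht1
    have h := (hmin _).trans (hF hx.le hb ht ht1)
    norm_cast at h
    rw [norm_sub_rev x y] at h
    have : t * (c + σ / 2 * (1 - t) * ‖y - x‖ ^ 2) ≤ t * b := by linarith
    exact le_of_mul_le_mul_left this ht
  have hlim : Filter.Tendsto (fun t : ℝ => c + σ / 2 * (1 - t) * ‖y - x‖ ^ 2)
      (nhdsWithin 0 (Set.Ioi 0)) (nhds (c + σ / 2 * (1 - 0) * ‖y - x‖ ^ 2)) :=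
    (Continuous.tendsto (by fun_prop) 0).mono_left nhdsWithin_le_nhds
  rw [sub_zero, mul_one] at hlim
  refine le_of_tendsto hlim ?_
  filter_upwards [Ioo_mem_nhdsGT (zero_lt_one (α := ℝ))] with t ht
  exact key t ht.1 ht.2

/-- A strongly convex lower semicontinuous proper function is bounded below: near a point of its
domain by semicontinuity, and far away because quadratic growth beats the linear term. -/
theorem IsClosedConvex.bddBelow {σ : ℝ} (hσ : 0 < σ) {F : H → EReal} (hF : IsClosedConvex σ F) :
    ∃ B : ℝ, ∀ y, (B : EReal) ≤ F y := by
  obtain ⟨x, c, hx⟩ := hF.proper.exists_coe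
  have hlt : ((c - 1 : ℝ) : EReal) < F x := by
    rw [hx]
    norm_cast
    linarith
  obtain ⟨r, hr, hball⟩ := Metric.eventually_nhds_iff.1 (hF.closed x _ hlt)
  refine ⟨c - 1 - 4 / (σ * r ^ 2), fun y => le_of_forall_real_upper_bound fun b hb => ?_⟩
  norm_cast
  have hpos : 0 < 4 / (σ * r ^ 2) := by positivity
  rcases lt_or_ge (dist y x) r with hd | hd
  · have := (hball hd).le.trans hb
    norm_cast at this
    linarith
  · have hd0 : 0 < dist y x := hr.trans_le hd
    -- The point at distance `r / 2` from `x` on the segment from `x` to `y` lies in the ball.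
    set t : ℝ := r / (2 * dist y x) with ht
    have htd : t * dist y x = r / 2 := by rw [ht]; field_simp
    have ht0 : 0 < t := by positivity
    have ht1 : t ≤ 1 / 2 := by
      rw [ht, div_le_iff₀ (by positivity)]
      linarith
    have hmem : dist ((1 - t) • x + t • y) x < r := by
      rw [dist_eq_norm, show (1 - t) • x + t • y - x = t • (y - x) by module, norm_smul,
        Real.norm_of_nonneg ht0.le, ← dist_eq_norm, htd]
      linarith
    have h := (hball hmem).le.trans (hF.epi hx.le hb ht0 (by linarith))
    norm_cast at h
    rw [norm_sub_rev x y, ← dist_eq_norm] at h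
    have h1 : t * (c - 2 / r * dist y x + σ / 4 * dist y x ^ 2) ≤ t * b := by
      have e1 : t * (2 / r * dist y x) = 1 := by
        rw [mul_left_comm, htd]
        field_simp
      have e2 : σ / 2 * (t * (1 / 2) * dist y x ^ 2) ≤ σ / 2 * (t * (1 - t) * dist y x ^ 2) := by
        gcongr
        linarith
      nlinarith
    have h2 := le_of_mul_le_mul_left h1 ht0
    have h3 : 0 ≤ σ / 4 * (dist y x - 4 / (σ * r)) ^ 2 := by positivity
    have h4 : σ / 4 * (dist y x - 4 / (σ * r)) ^ 2
        = σ / 4 * dist y x ^ 2 - 2 / r * dist y x + 4 / (σ * r ^ 2) := by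
      field_simp
      ring
    linarith

/-- A proper lower semicontinuous strongly convex function on a Hilbert space has a minimizer,
since by strong convexity minimizing sequences are Cauchy. -/
theorem IsClosedConvex.exists_min [CompleteSpace H] {σ : ℝ} (hσ : 0 < σ) {F : H → EReal}
    (hF : IsClosedConvex σ F) : ∃ (x : H) (c : ℝ), F x = c ∧ ∀ y, (c : EReal) ≤ F y := by
  obtain ⟨B, hB⟩ := hF.bddBelow hσ
  obtain ⟨x₀, c₀, hx₀⟩ := hF.proper.exists_coe
  set S : Set ℝ := {b | ∃ y, F y ≤ b} with hS
  have hne : S.Nonempty := ⟨c₀, x₀, hx₀.le⟩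
  have hbdd : BddBelow S := ⟨B, fun b ⟨y, hy⟩ => by exact_mod_cast (hB y).trans hy⟩
  set μ := sInf S
  have hμ : ∀ y, (μ : EReal) ≤ F y := fun y =>
    le_of_forall_real_upper_bound fun b hb => by exact_mod_cast csInf_le hbdd ⟨y, hb⟩
  have hseq : ∀ n : ℕ, ∃ y, F y ≤ ((μ + 1 / ((n : ℝ) + 1) : ℝ) : EReal) := by
    intro n
    obtain ⟨b, ⟨y, hy⟩, hb⟩ := exists_lt_of_csInf_lt hne
      (show μ < μ + 1 / ((n : ℝ) + 1) by linarith [Nat.one_div_pos_of_nat (α := ℝ) (n := n)])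
    exact ⟨y, hy.trans (by exact_mod_cast hb.le)⟩
  choose s hs using hseq
  have hsN : ∀ n N : ℕ, N ≤ n → F (s n) ≤ ((μ + 1 / ((N : ℝ) + 1) : ℝ) : EReal) := by
    intro n N h
    refine (hs n).trans ?_
    norm_cast
    gcongr
  have hcauchy : CauchySeq s := by
    refine cauchySeq_of_le_tendsto_0 (fun N : ℕ => Real.sqrt (8 / σ * (1 / ((N : ℝ) + 1)))) ?_ ?_
    · intro n k N hn hk
      have h := (hμ _).trans (hF.epi (hsN n N hn) (hsN k N hk) (t := 1 / 2) (by norm_num)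
        (by norm_num))
      rw [EReal.coe_le_coe_iff] at h
      refine Real.le_sqrt_of_sq_le ?_
      rw [dist_eq_norm, div_mul_eq_mul_div, le_div_iff₀ hσ]
      linarith
    · have h := (tendsto_one_div_add_atTop_nhds_zero_nat (𝕜 := ℝ)).const_mul (8 / σ)
      have h' := (Real.continuous_sqrt.tendsto _).comp h
      simpa [Function.comp_def] using h'
  obtain ⟨x, hx⟩ := cauchySeq_tendsto_of_complete hcauchy
  have hle : F x ≤ μ := by
    by_contra! hcon
    obtain ⟨m', h1, h2⟩ := EReal.lt_iff_exists_real_btwn.1 hcon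
    have h1' : μ < m' := by exact_mod_cast h1
    have hev := hx.eventually (hF.closed x _ h2)
    have hev2 : ∀ᶠ n : ℕ in Filter.atTop, 1 / ((n : ℝ) + 1) < m' - μ :=
      (tendsto_one_div_add_atTop_nhds_zero_nat (𝕜 := ℝ)).eventually_lt_const (by linarith)
    obtain ⟨n, hn1, hn2⟩ := (hev.and hev2).exists
    have := EReal.coe_lt_coe_iff.1 (hn1.trans_le (hs n))
    linarith
  exact ⟨x, μ, le_antisymm hle (hμ x), hμ⟩

end Epigraph

/-! ### Subgradients, proximal points and Fenchel conjugates -/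

section Subgradient

variable {H : Type*} [NormedAddCommGroup H] [InnerProductSpace ℝ H]

theorem mem_subdifferential_iff {F : H → EReal} (hF : ∀ x, F x ≠ ⊥) {x w : H} :
    w ∈ subdifferential F x ↔
      ∃ c : ℝ, F x = c ∧ ∀ y, ((c + ⟪y - x, w⟫_ℝ : ℝ) : EReal) ≤ F y := by
  constructor
  · rintro ⟨h1, h2⟩
    have hx := (EReal.coe_toReal h1.ne (hF x)).symm
    refine ⟨_, hx, fun y => ?_⟩
    have := h2 y
    rw [hx] at this
    rw [add_comm]
    exact_mod_cast this
  · rintro ⟨c, hc, h⟩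
    refine ⟨hc ▸ EReal.coe_lt_top c, fun y => ?_⟩
    have := h y
    rw [add_comm] at this
    rw [hc]
    exact_mod_cast this

/-- Every subgradient inequality of `F` improves by the quadratic term `σ / 2 * ‖y - x‖ ^ 2`. -/
def SubgradientGrowth (σ : ℝ) (F : H → EReal) : Prop :=
  ∀ ⦃x w : H⦄ ⦃c : ℝ⦄, w ∈ subdifferential F x → F x = c →
    ∀ y, ((c + ⟪y - x, w⟫_ℝ + σ / 2 * ‖y - x‖ ^ 2 : ℝ) : EReal) ≤ F y

theorem SubgradientGrowth.strong_monotone {σ : ℝ} {F : H → EReal} (hF : ∀ x, F x ≠ ⊥)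
    (hg : SubgradientGrowth σ F) {x x' w w' : H} (h : w ∈ subdifferential F x)
    (h' : w' ∈ subdifferential F x') : σ * ‖x - x'‖ ^ 2 ≤ ⟪x - x', w - w'⟫_ℝ := by
  obtain ⟨c, hc, -⟩ := (mem_subdifferential_iff hF).1 h
  obtain ⟨c', hc', -⟩ := (mem_subdifferential_iff hF).1 h'
  have h1 := hg h hc x'
  have h2 := hg h' hc' x
  rw [hc'] at h1
  rw [hc] at h2
  norm_cast at h1 h2
  rw [norm_sub_rev x' x] at h1
  rw [← neg_sub x x', inner_neg_left] at h1
  rw [inner_sub_right]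
  linarith

theorem IsClosedConvex.subgradientGrowth {σ : ℝ} {F : H → EReal} (hF : IsClosedConvex σ F) :
    SubgradientGrowth σ F := by
  intro x w c hw hc y
  obtain ⟨c', hc', h⟩ := (mem_subdifferential_iff hF.proper.1).1 hw
  obtain rfl : c = c' := by exact_mod_cast hc.symm.trans hc'
  -- Subtracting the linear function `⟪·, w⟫` turns `x` into a minimizer.
  have hcc := hF.add_coe (κ := 0) (φ := fun y => -⟪y, w⟫_ℝ) (by fun_prop) (by
    intro x y t _ _
    simp only [inner_add_left, inner_smul_left, conj_trivial]
    linarith)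
  have hx : F x + ((-⟪x, w⟫_ℝ : ℝ) : EReal) = ((c - ⟪x, w⟫_ℝ : ℝ) : EReal) := by
    rw [hc]
    norm_cast
  have hshift : ∀ {e : ℝ} {y : H}, ((e + ⟪y, w⟫_ℝ : ℝ) : EReal) ≤ F y ↔
      (e : EReal) ≤ F y + ((-⟪y, w⟫_ℝ : ℝ) : EReal) := by
    intro e y
    rw [EReal.coe_add, ← EReal.le_sub_iff_add_le (.inl (EReal.coe_ne_bot _))
      (.inl (EReal.coe_ne_top _)), sub_eq_add_neg, EReal.coe_neg]
  have hg := hcc.epi.growth hx (fun y => hshift.1 (by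
    refine le_trans (le_of_eq ?_) (h y)
    rw [inner_sub_left]
    congr 1
    ring)) y
  refine le_trans (le_of_eq ?_) (hshift.2 hg)
  rw [inner_sub_left]
  congr 1
  ring

/-- The proximal point of `p` is characterized by the optimality condition
`p - prox F p ∈ ∂ F (prox F p)`. -/
theorem IsClosedConvex.sub_prox_mem [CompleteSpace H] {F : H → EReal} (hF : IsClosedConvex 0 F)
    (p : H) : p - prox F p ∈ subdifferential F (prox F p) := by
  have hQ := hF.add_coe (κ := 1) (φ := fun y => 1 / 2 * ‖p - y‖ ^ 2) (by fun_prop) (by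
    intro x y t _ _
    rw [show p - ((1 - t) • x + t • y) = (1 - t) • (p - x) + t • (p - y) by module,
      norm_sq_convex_comb, show p - x - (p - y) = -(x - y) by abel, norm_neg]
    linarith)
  have hex : ∃ y : H, ∀ w : H, F y + ((1 / 2 * ‖p - y‖ ^ 2 : ℝ) : EReal)
      ≤ F w + ((1 / 2 * ‖p - w‖ ^ 2 : ℝ) : EReal) := by
    obtain ⟨x, c, hc, h⟩ := hQ.exists_min (by norm_num)
    exact ⟨x, fun w => hc.trans_le (h w)⟩
  have hmin := Classical.epsilon_spec hex
  change ∀ w : H, F (prox F p) + ((1 / 2 * ‖p - prox F p‖ ^ 2 : ℝ) : EReal)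
      ≤ F w + ((1 / 2 * ‖p - w‖ ^ 2 : ℝ) : EReal) at hmin
  set x := prox F p
  obtain ⟨x₀, c₀, hx₀⟩ := hF.proper.exists_coe
  have hfin : F x + ((1 / 2 * ‖p - x‖ ^ 2 : ℝ) : EReal)
      ≤ ((c₀ + 1 / 2 * ‖p - x₀‖ ^ 2 : ℝ) : EReal) := by
    have := hmin x₀
    rw [hx₀] at this
    exact_mod_cast this
  obtain ⟨d, hd, -⟩ := eq_coe_of_le hQ.proper.1 hfin
  have hg := hQ.epi.growth hd (fun y => hd ▸ hmin y)
  have hFx : F x = ((d - 1 / 2 * ‖p - x‖ ^ 2 : ℝ) : EReal) := by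
    rw [EReal.coe_sub, ← hd, EReal.add_sub_cancel_right]
  refine (mem_subdifferential_iff hF.proper.1).2 ⟨_, hFx, fun y => ?_⟩
  refine le_of_forall_real_upper_bound fun b hb => ?_
  have h1 := (hg y).trans (add_le_add_left hb _)
  norm_cast at h1 ⊢
  have e : ‖p - y‖ ^ 2 = ‖p - x‖ ^ 2 - 2 * ⟪y - x, p - x⟫_ℝ + ‖y - x‖ ^ 2 := by
    rw [show p - y = (p - x) - (y - x) by abel, norm_sub_sq_real, real_inner_comm]
  rw [e] at h1
  linarith

end Subgradient

section Conjugate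

variable {H : Type*} [NormedAddCommGroup H] [InnerProductSpace ℝ H]

/-- The Fenchel–Young inequality. -/
theorem le_conj {F : H → EReal} {x : H} {c : ℝ} (hx : F x ≤ c) (w : H) :
    ((⟪x, w⟫_ℝ - c : ℝ) : EReal) ≤ conj F w := by
  refine le_trans ?_ (le_iSup (fun x : H => ((⟪x, w⟫_ℝ : ℝ) : EReal) - F x) x)
  rw [EReal.coe_sub]
  exact EReal.sub_le_sub le_rfl hx

theorem conj_ne_bot {F : H → EReal} (hF : Proper F) (w : H) : conj F w ≠ ⊥ := by
  obtain ⟨x, c, hx⟩ := hF.exists_coe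
  exact ((EReal.bot_lt_coe _).trans_le (le_conj hx.le w)).ne'

/-- Equality in the Fenchel–Young inequality at a subgradient. -/
theorem conj_eq_of_mem_subdifferential {F : H → EReal} (hF : Proper F) {x w : H} {c : ℝ}
    (h : w ∈ subdifferential F x) (hx : F x = c) :
    conj F w = ((⟪x, w⟫_ℝ - c : ℝ) : EReal) := by
  refine le_antisymm (iSup_le fun y => ?_) (le_conj hx.le w)
  obtain ⟨c', hc', h'⟩ := (mem_subdifferential_iff hF.1).1 h
  obtain rfl : c = c' := by exact_mod_cast hx.symm.trans hc'
  refine (EReal.sub_le_sub le_rfl (h' y)).trans ?_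
  norm_cast
  rw [inner_sub_left]
  linarith

theorem mem_subdifferential_conj {F : H → EReal} (hF : Proper F) {x w : H}
    (h : w ∈ subdifferential F x) : x ∈ subdifferential (conj F) w := by
  obtain ⟨c, hc, -⟩ := (mem_subdifferential_iff hF.1).1 h
  refine (mem_subdifferential_iff (conj_ne_bot hF)).2
    ⟨_, conj_eq_of_mem_subdifferential hF h hc, fun y => ?_⟩
  refine le_trans (le_of_eq ?_) (le_conj hc.le y)
  rw [inner_sub_left, real_inner_comm x y, real_inner_comm x w]
  congr 1
  ring

theorem IsClosedConvex.exists_mem_subdifferential [CompleteSpace H] {σ : ℝ} (hσ : 0 < σ)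
    {F : H → EReal} (hF : IsClosedConvex σ F) (w : H) : ∃ x, w ∈ subdifferential F x := by
  have hcc := hF.add_coe (κ := 0) (φ := fun y => -⟪y, w⟫_ℝ) (by fun_prop) (by
    intro x y t _ _
    simp only [inner_add_left, inner_smul_left, conj_trivial]
    linarith)
  obtain ⟨x, c, hc, hmin⟩ := hcc.exists_min (by linarith)
  have hx : F x = ((c + ⟪x, w⟫_ℝ : ℝ) : EReal) := by
    rw [EReal.coe_add, ← hc, add_assoc, ← EReal.coe_add]
    simp
  refine ⟨x, (mem_subdifferential_iff hF.proper.1).2 ⟨_, hx, fun y => ?_⟩⟩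
  refine le_of_forall_real_upper_bound fun b hb => ?_
  have h1 := (hmin y).trans (add_le_add_left hb _)
  norm_cast at h1 ⊢
  rw [inner_sub_left]
  linarith

/-- For a strongly convex function, points are Lipschitz functions of their subgradients. -/
theorem IsClosedConvex.norm_sub_le_of_mem_subdifferential {σ : ℝ} (hσ : 0 < σ)
    {F : H → EReal} (hF : IsClosedConvex σ F) {x x' w w' : H} (h : w ∈ subdifferential F x)
    (h' : w' ∈ subdifferential F x') : ‖x - x'‖ ≤ σ⁻¹ * ‖w - w'‖ := by
  have h1 := (hF.subgradientGrowth.strong_monotone hF.proper.1 h h').trans (real_inner_le_norm _ _)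
  rcases (norm_nonneg (x - x')).eq_or_lt with h0 | h0
  · rw [← h0]
    positivity
  · rw [inv_mul_eq_div, le_div_iff₀ hσ]
    refine le_of_mul_le_mul_left ?_ h0
    linarith

/-- The conjugate of a strongly convex function is differentiable, and its gradient inverts the
subdifferential. -/
theorem IsClosedConvex.grad_conj [CompleteSpace H] {σ : ℝ} (hσ : 0 < σ) {F : H → EReal}
    (hF : IsClosedConvex σ F) {x w : H} (h : w ∈ subdifferential F x) :
    grad (conj F) w = x := by
  refine HasGradientAt.gradient ?_
  rw [hasGradientAt_iff_isLittleO]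
  have key : ∀ w', ‖(conj F w').toReal - (conj F w).toReal - ⟪x, w' - w⟫_ℝ‖
      ≤ σ⁻¹ * ‖w' - w‖ ^ 2 := by
    intro w'
    obtain ⟨x', hx'⟩ := hF.exists_mem_subdifferential hσ w'
    obtain ⟨c, hc, h1⟩ :=
      (mem_subdifferential_iff (conj_ne_bot hF.proper)).1 (mem_subdifferential_conj hF.proper h)
    obtain ⟨c', hc', h2⟩ :=
      (mem_subdifferential_iff (conj_ne_bot hF.proper)).1 (mem_subdifferential_conj hF.proper hx')
    have h3 := h1 w'
    have h4 := h2 w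
    rw [hc'] at h3
    rw [hc] at h4
    rw [hc, hc', EReal.toReal_coe, EReal.toReal_coe]
    norm_cast at h3 h4
    have h5 : ⟪w' - w, x' - x⟫_ℝ ≤ σ⁻¹ * ‖w' - w‖ ^ 2 := by
      refine (real_inner_le_norm _ _).trans ?_
      rw [pow_two, mul_left_comm]
      exact mul_le_mul_of_nonneg_left (hF.norm_sub_le_of_mem_subdifferential hσ hx' h)
        (norm_nonneg _)
    rw [← neg_sub w' w, inner_neg_left] at h4
    rw [inner_sub_right] at h5
    rw [real_inner_comm, Real.norm_eq_abs, abs_le]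
    constructor <;> linarith
  refine (Asymptotics.IsBigO.of_bound σ⁻¹ (g := fun w' => ‖w' - w‖ ^ 2) ?_).trans_isLittleO ?_
  · filter_upwards with w'
    simpa using key w'
  · exact Asymptotics.isLittleO_pow_sub_sub w one_lt_two

end Conjugate

section Smooth

variable {H : Type*} [NormedAddCommGroup H] [InnerProductSpace ℝ H] [CompleteSpace H]

/-- The first-order condition for a differentiable convex function. -/
theorem add_inner_gradient_le {φ : H → ℝ} (hc : ConvexOn ℝ Set.univ φ) (hd : Differentiable ℝ φ)
    (x y : H) : φ x + ⟪y - x, gradient φ x⟫_ℝ ≤ φ y := by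
  have hconv : ConvexOn ℝ Set.univ fun t : ℝ => φ (AffineMap.lineMap x y t) :=
    hc.comp_affineMap (AffineMap.lineMap x y)
  have hline : HasDerivAt (fun t : ℝ => AffineMap.lineMap x y t) (y - x) 0 :=
    AffineMap.hasDerivAt_lineMap
  have hder : HasDerivAt (fun t : ℝ => φ (AffineMap.lineMap x y t))
      (⟪gradient φ x, y - x⟫_ℝ) 0 := by
    have h1 : HasFDerivAt φ (InnerProductSpace.toDual ℝ H (gradient φ x))
        (AffineMap.lineMap x y (0 : ℝ)) := by
      rw [AffineMap.lineMap_apply_zero]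
      exact (hd x).hasGradientAt
    have h2 := h1.comp_hasDerivAt (0 : ℝ) hline
    rw [InnerProductSpace.toDual_apply_apply] at h2
    exact h2
  have h := hconv.le_slope_of_hasDerivAt (Set.mem_univ 0) (Set.mem_univ 1) zero_lt_one hder
  rw [slope_def_field] at h
  simp only [AffineMap.lineMap_apply_zero, AffineMap.lineMap_apply_one] at h
  rw [real_inner_comm]
  linarith

theorem ConvexLipschitzGradient.proper {L : ℝ≥0} {F : H → EReal}
    (hF : ConvexLipschitzGradient L F) : Proper F := by
  obtain ⟨φ, hφ, -⟩ := hF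
  exact ⟨fun x => by simp [hφ], 0, by simp [hφ, EReal.coe_lt_top]⟩

theorem ConvexLipschitzGradient.isClosedConvex {L : ℝ≥0} {F : H → EReal}
    (hF : ConvexLipschitzGradient L F) : IsClosedConvex 0 F := by
  refine ⟨hF.proper, ?_, ?_⟩ <;> obtain ⟨φ, hφ, hc, hd, -⟩ := hF
  · rw [show F = fun x => (φ x : EReal) from funext hφ]
    exact (continuous_coe_real_ereal.comp hd.continuous).lowerSemicontinuous
  · intro x y a b ha hb t ht ht1
    simp only [hφ] at ha hb ⊢
    norm_cast at ha hb ⊢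
    have h := hc.2 (Set.mem_univ x) (Set.mem_univ y) (sub_nonneg.2 ht1.le) ht.le (by ring)
    simp only [smul_eq_mul] at h
    nlinarith [mul_le_mul_of_nonneg_left ha (sub_nonneg.2 ht1.le),
      mul_le_mul_of_nonneg_left hb ht.le]

theorem ConvexLipschitzGradient.grad_mem_subdifferential {L : ℝ≥0} {F : H → EReal}
    (hF : ConvexLipschitzGradient L F) (x : H) : grad F x ∈ subdifferential F x := by
  refine (mem_subdifferential_iff hF.proper.1).2 ?_
  obtain ⟨φ, hφ, hc, hd, -⟩ := hF
  refine ⟨φ x, hφ x, fun y => ?_⟩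
  simp only [grad, hφ, EReal.toReal_coe]
  exact_mod_cast add_inner_gradient_le hc hd x y

theorem ConvexLipschitzGradient.eq_grad {L : ℝ≥0} {F : H → EReal}
    (hF : ConvexLipschitzGradient L F) {x w : H} (h : w ∈ subdifferential F x) :
    w = grad F x := by
  obtain ⟨c, hc, h⟩ := (mem_subdifferential_iff hF.proper.1).1 h
  obtain ⟨φ, hφ, -, hd, -⟩ := hF
  simp only [grad, hφ, EReal.toReal_coe] at hc h ⊢
  norm_cast at hc h
  have hmin : IsLocalMin (fun y => φ y - ⟪w, y⟫_ℝ) x := by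
    filter_upwards with y
    have := h y
    rw [inner_sub_left, real_inner_comm, real_inner_comm w x] at this
    linarith
  have h1 : HasFDerivAt φ (InnerProductSpace.toDual ℝ H (gradient φ x)) x :=
    (hd x).hasGradientAt
  have h2 := hmin.hasFDerivAt_eq_zero (h1.sub (InnerProductSpace.toDual ℝ H w).hasFDerivAt)
  rw [← map_sub, LinearIsometryEquiv.map_eq_zero_iff, sub_eq_zero] at h2
  exact h2.symm

theorem ConvexLipschitzGradient.norm_grad_sub_le {L : ℝ≥0} {F : H → EReal}
    (hF : ConvexLipschitzGradient L F) (x y : H) : ‖grad F x - grad F y‖ ≤ L * ‖x - y‖ := by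
  obtain ⟨φ, hφ, -, -, hl⟩ := hF
  have hg : grad F = gradient φ := by
    funext z
    simp only [grad, hφ, EReal.toReal_coe]
  rw [hg]
  exact hl.norm_sub_le x y

/-- Subgradients of the conjugate of a smooth function come from subgradients of the function. -/
theorem ConvexLipschitzGradient.mem_subdifferential_of_conj {L : ℝ≥0} {F : H → EReal}
    (hF : ConvexLipschitzGradient L F) {x w : H} (h : x ∈ subdifferential (conj F) w) :
    w ∈ subdifferential F x := by
  obtain ⟨c, hc, h⟩ := (mem_subdifferential_iff (conj_ne_bot hF.proper)).1 h
  obtain ⟨d, hd, hg⟩ := (mem_subdifferential_iff hF.proper.1).1 (hF.grad_mem_subdifferential x)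
  refine (mem_subdifferential_iff hF.proper.1).2 ⟨d, hd, fun y => ?_⟩
  -- Test the subgradient inequality of the conjugate at `∇ F x`, where the conjugate is known.
  have h1 := h (grad F x)
  rw [conj_eq_of_mem_subdifferential hF.proper (hF.grad_mem_subdifferential x) hd] at h1
  refine le_of_forall_real_upper_bound fun b hb => ?_
  have h2 := le_conj hb w
  rw [hc] at h2
  norm_cast at h1 h2 ⊢
  rw [inner_sub_left] at h1 ⊢
  rw [real_inner_comm x (grad F x), real_inner_comm x w] at h1
  linarith

/-- The conjugate of a function with `L`-Lipschitz gradient is strongly convex. The modulus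
`1 / (2 * (L + 1))` is not optimal, but it makes sense for `L = 0` and follows from the descent
inequality with the constant `L` in place of `L / 2`, which needs no integration. -/
theorem ConvexLipschitzGradient.subgradientGrowth_conj {L : ℝ≥0} {F : H → EReal}
    (hF : ConvexLipschitzGradient L F) :
    SubgradientGrowth (1 / (2 * ((L : ℝ) + 1))) (conj F) := by
  intro w x c hx hc w'
  have hw := hF.mem_subdifferential_of_conj hx
  obtain ⟨d, hd, -⟩ := (mem_subdifferential_iff hF.proper.1).1 hw
  have hc' := conj_eq_of_mem_subdifferential hF.proper hw hd
  obtain rfl : c = ⟪x, w⟫_ℝ - d := by exact_mod_cast hc.symm.trans hc'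
  set s : ℝ := 1 / (2 * ((L : ℝ) + 1)) with hs
  have hL : (0 : ℝ) ≤ L := L.2
  have hs0 : 0 < s := by positivity
  set y : H := x + s • (w' - w) with hy
  obtain ⟨e, he, -⟩ := (mem_subdifferential_iff hF.proper.1).1 (hF.grad_mem_subdifferential y)
  have hdesc : e ≤ d + s * ⟪w' - w, w⟫_ℝ + L * (s ^ 2 * ‖w' - w‖ ^ 2) := by
    obtain ⟨e', he', hsub⟩ :=
      (mem_subdifferential_iff hF.proper.1).1 (hF.grad_mem_subdifferential y)
    obtain rfl : e = e' := by exact_mod_cast he.symm.trans he'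
    have h1 := hsub x
    rw [hd] at h1
    norm_cast at h1
    have h2 : ⟪y - x, grad F y - w⟫_ℝ ≤ L * ‖y - x‖ ^ 2 := by
      refine (real_inner_le_norm _ _).trans ?_
      rw [pow_two, mul_left_comm, hF.eq_grad hw]
      exact mul_le_mul_of_nonneg_left (hF.norm_grad_sub_le y x) (norm_nonneg _)
    have hyx : y - x = s • (w' - w) := by rw [hy]; abel
    rw [← neg_sub y x, inner_neg_left] at h1
    rw [inner_sub_right] at h2
    have h3 : ⟪y - x, w⟫_ℝ = s * ⟪w' - w, w⟫_ℝ := by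
      rw [hyx, inner_smul_left, conj_trivial]
    have h4 : ‖y - x‖ ^ 2 = s ^ 2 * ‖w' - w‖ ^ 2 := by
      rw [hyx, norm_smul, mul_pow, Real.norm_eq_abs, sq_abs]
    rw [h3, h4] at h2
    linarith
  refine le_trans ?_ (le_conj he.le w')
  norm_cast
  have h5 : ⟪y, w'⟫_ℝ = ⟪x, w'⟫_ℝ + s * (⟪w' - w, w⟫_ℝ + ‖w' - w‖ ^ 2) := by
    rw [hy, inner_add_left, inner_smul_left, conj_trivial, ← real_inner_self_eq_norm_sq,
      ← inner_add_right, add_sub_cancel]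
  have h6 : L * s ^ 2 ≤ s / 2 := by
    have : s * (2 * ((L : ℝ) + 1)) = 1 := by rw [hs]; field_simp
    nlinarith
  have h7 := mul_le_mul_of_nonneg_right h6 (sq_nonneg ‖w' - w‖)
  rw [h5, inner_sub_left, real_inner_comm x w', real_inner_comm x w]
  nlinarith

end Smooth

/-! ### Energy identity and contraction for the resolvent splitting -/

section Splitting

/-- The arguments of the resolvents of `A_2, …, A_n` in the splitting scheme:
`z_{j+1} + x_j - z_j` for `j ≤ n - 2`, and `x_1 + x_{n-1} - z_{n-1}` for the last one. -/
def splittingInput {E : Type*} [AddCommGroup E] {m : ℕ} (z : Fin (m + 1) → E)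
    (x : Fin (m + 2) → E) (j : Fin (m + 1)) : E :=
  Fin.snoc (α := fun _ => E) (fun i : Fin m => z i.succ) (x 0) j + x j.castSucc - z j

/-- The linear relations between the governing point `z`, the resolvent values `x` and the
operator values `a i ∈ A_i (x i)` in one step of the splitting scheme. -/
structure IsSplitting {E : Type*} [AddCommGroup E] {m : ℕ} (z : Fin (m + 1) → E)
    (x a : Fin (m + 2) → E) : Prop where
  first : x 0 + a 0 = z 0
  next : ∀ j : Fin (m + 1), x j.succ + a j.succ = splittingInput z x j

section AddCommGroup

variable {E : Type*} [AddCommGroup E] {m : ℕ} {z z' : Fin (m + 1) → E} {x x' a a' : Fin (m + 2) → E}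

@[simp]
theorem splittingInput_castSucc (z : Fin (m + 1) → E) (x : Fin (m + 2) → E) (i : Fin m) :
    splittingInput z x i.castSucc = z i.succ + x i.castSucc.castSucc - z i.castSucc := by
  simp [splittingInput]

@[simp]
theorem splittingInput_last (z : Fin (m + 1) → E) (x : Fin (m + 2) → E) :
    splittingInput z x (Fin.last m) = x 0 + x (Fin.last m).castSucc - z (Fin.last m) := by
  simp [splittingInput]

theorem splittingInput_map {E' : Type*} [AddCommGroup E'] (φ : E →+ E') (z : Fin (m + 1) → E)
    (x : Fin (m + 2) → E) (j : Fin (m + 1)) :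
    splittingInput (fun i => φ (z i)) (fun i => φ (x i)) j = φ (splittingInput z x j) := by
  induction j using Fin.lastCases <;> simp

theorem IsSplitting.sub (h : IsSplitting z x a) (h' : IsSplitting z' x' a') :
    IsSplitting (fun i => z i - z' i) (fun i => x i - x' i) (fun i => a i - a' i) := by
  refine ⟨?_, fun j => ?_⟩
  · simp only [← h.first, ← h'.first]
    abel
  · have h1 : splittingInput (fun i => z i - z' i) (fun i => x i - x' i) j
        = splittingInput z x j - splittingInput z' x' j := by
      induction j using Fin.lastCases <;> simp <;> abel
    rw [h1, ← h.next, ← h'.next]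
    abel

theorem IsSplitting.sum_eq (h : IsSplitting z x a) :
    ∑ i, a i = x 0 - x (Fin.last (m + 1)) := by
  have ha : ∑ j : Fin (m + 1), a j.succ = ∑ j : Fin (m + 1), (splittingInput z x j - x j.succ) :=
    Finset.sum_congr rfl fun j _ => by rw [← h.next j]; abel
  rw [Fin.sum_univ_succ, ha, Fin.sum_univ_castSucc]
  have h1 := h.first
  have tz : ∑ i : Fin m, z i.succ + z 0 = ∑ i : Fin m, z i.castSucc + z (Fin.last m) := by
    rw [← Fin.sum_univ_castSucc, Fin.sum_univ_succ, add_comm]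
  have tx : ∑ i : Fin m, x i.castSucc.succ + x 0
      = ∑ i : Fin m, x i.castSucc.castSucc + x (Fin.last m).castSucc := by
    have := (Fin.sum_univ_castSucc fun i : Fin (m + 1) => x i.castSucc).symm.trans
      (Fin.sum_univ_succ fun i : Fin (m + 1) => x i.castSucc)
    rw [this, add_comm]
    rfl
  simp only [splittingInput_castSucc, splittingInput_last, Finset.sum_sub_distrib,
    Finset.sum_add_distrib, Fin.succ_last]
  have e1 : a 0 = z 0 - x 0 := by rw [← h1]; abel
  have e2 := eq_sub_of_add_eq tz
  have e3 := eq_sub_of_add_eq tx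
  rw [e1, e2, e3]
  abel

end AddCommGroup

section Norm

variable {E : Type*} [NormedAddCommGroup E] {m : ℕ} {z : Fin (m + 1) → E} {x a : Fin (m + 2) → E}

/-- All points of a chain are controlled by the last point and the displacements. -/
theorem norm_le_of_norm_last_le {N : ℝ} (hlast : ‖x (Fin.last (m + 1))‖ ≤ N)
    (hd : ∀ i : Fin (m + 1), ‖x i.succ - x i.castSucc‖ ≤ N) (i : Fin (m + 2)) :
    ‖x i‖ ≤ (m + 2) * N := by
  have hN : 0 ≤ N := (norm_nonneg _).trans hlast
  have key : ‖x i‖ ≤ (m + 2 - (i : ℕ)) * N := by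
    induction i using Fin.reverseInduction with
    | last =>
      simp only [Fin.val_last]
      push_cast
      linarith
    | cast i ih =>
      have h1 : ‖x i.castSucc‖ ≤ ‖x i.succ‖ + ‖x i.succ - x i.castSucc‖ := by
        simpa using norm_sub_le (x i.succ) (x i.succ - x i.castSucc)
      have h2 := hd i
      simp only [Fin.val_succ, Fin.val_castSucc] at ih ⊢
      push_cast at ih
      linarith
  refine key.trans (mul_le_mul_of_nonneg_right ?_ hN)
  linarith [Nat.cast_nonneg (α := ℝ) (i : ℕ)]

/-- Lipschitz continuity of all operators but the last lets the points control `z`. -/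
theorem IsSplitting.norm_le (h : IsSplitting z x a) {L B : ℝ} (hL : 0 ≤ L)
    (hB : ∀ i, ‖x i‖ ≤ B) (ha : ∀ i : Fin (m + 1), ‖a i.castSucc‖ ≤ L * ‖x i.castSucc‖)
    (i : Fin (m + 1)) : ‖z i‖ ≤ (m + 1) * ((2 + L) * B) := by
  have hB0 : 0 ≤ B := (norm_nonneg _).trans (hB 0)
  have haB : ∀ i : Fin (m + 1), ‖a i.castSucc‖ ≤ L * B := fun i =>
    (ha i).trans (mul_le_mul_of_nonneg_left (hB _) hL)
  have key : ‖z i‖ ≤ ((i : ℕ) + 1) * ((2 + L) * B) := by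
    induction i using Fin.induction with
    | zero =>
      have h1 := norm_add_le (x 0) (a 0)
      have h2 := haB 0
      rw [h.first] at h1
      simp only [Fin.castSucc_zero] at h2
      simp only [Fin.val_zero, Nat.cast_zero]
      linarith [hB 0]
    | succ i ih =>
      have h1 := h.next i.castSucc
      rw [splittingInput_castSucc] at h1
      have h2 : z i.succ = x i.castSucc.succ + a i.castSucc.succ - x i.castSucc.castSucc
          + z i.castSucc := by rw [h1]; abel
      have h3 : ‖z i.succ‖ ≤ ‖x i.castSucc.succ‖ + ‖a i.castSucc.succ‖ + ‖x i.castSucc.castSucc‖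
          + ‖z i.castSucc‖ := by
        rw [h2]
        exact (norm_add_le _ _).trans (add_le_add_left
          ((norm_sub_le _ _).trans (add_le_add_left (norm_add_le _ _) _)) _)
      have h4 := haB i.succ
      rw [← Fin.succ_castSucc] at h4
      simp only [Fin.val_succ, Fin.val_castSucc] at ih ⊢
      push_cast
      linarith [hB i.castSucc.succ, hB i.castSucc.castSucc]
  refine key.trans (mul_le_mul_of_nonneg_right ?_ (by positivity))
  have : (i : ℕ) ≤ m := Nat.lt_succ_iff.1 i.2
  have : ((i : ℕ) : ℝ) ≤ m := by exact_mod_cast this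
  linarith

end Norm

variable {E : Type*} [NormedAddCommGroup E] [InnerProductSpace ℝ E] {m : ℕ}
  {z : Fin (m + 1) → E} {x a : Fin (m + 2) → E}

/-- The sum of the inner products `⟪x i, a i⟫` that monotonicity controls, in terms of the
displacement `x_{i+1} - x_i`. -/
theorem IsSplitting.sum_inner (h : IsSplitting z x a) :
    ∑ i, ⟪x i, a i⟫_ℝ = ∑ i : Fin (m + 1), ⟪z i, x i.castSucc - x i.succ⟫_ℝ
      - (∑ i : Fin (m + 1), ‖x i.succ - x i.castSucc‖ ^ 2) / 2
      - ‖x 0 - x (Fin.last (m + 1))‖ ^ 2 / 2 := by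
  have ha : ∑ j : Fin (m + 1), ⟪x j.succ, a j.succ⟫_ℝ
      = ∑ j : Fin (m + 1), ⟪x j.succ, splittingInput z x j - x j.succ⟫_ℝ :=
    Finset.sum_congr rfl fun j _ => by rw [← h.next j, add_sub_cancel_left]
  have ha0 : a 0 = z 0 - x 0 := by rw [← h.first, add_sub_cancel_left]
  rw [Fin.sum_univ_succ, ha, Fin.sum_univ_castSucc, ha0]
  have t1 := Fin.sum_univ_succ fun i : Fin (m + 1) => ⟪z i, x i.castSucc⟫_ℝ
  have t2 := Fin.sum_univ_castSucc fun i : Fin (m + 1) => ⟪z i, x i.succ⟫_ℝ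
  have t3 := Fin.sum_univ_castSucc fun i : Fin (m + 1) => ‖x i.succ‖ ^ 2
  have t4 := Fin.sum_univ_succ fun i : Fin (m + 1) => ‖x i.castSucc‖ ^ 2
  have t5 := Fin.sum_univ_castSucc fun i : Fin (m + 1) => ⟪x i.succ, x i.castSucc⟫_ℝ
  simp only [splittingInput_castSucc, splittingInput_last, inner_sub_right, inner_add_right,
    Finset.sum_sub_distrib, Finset.sum_add_distrib, norm_sub_sq_real, ← Finset.mul_sum,
    Fin.succ_last, Fin.succ_castSucc, Fin.castSucc_zero, real_inner_self_eq_norm_sq]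
    at t1 t2 t3 t4 t5 ⊢
  have c1 : ∀ (s : Finset (Fin m)), ∑ i ∈ s, ⟪x i.succ.castSucc, z i.succ⟫_ℝ
      = ∑ i ∈ s, ⟪z i.succ, x i.succ.castSucc⟫_ℝ :=
    fun s => Finset.sum_congr rfl fun i _ => real_inner_comm _ _
  have c2 : ∀ (s : Finset (Fin m)), ∑ i ∈ s, ⟪x i.succ.castSucc, z i.castSucc⟫_ℝ
      = ∑ i ∈ s, ⟪z i.castSucc, x i.succ.castSucc⟫_ℝ :=
    fun s => Finset.sum_congr rfl fun i _ => real_inner_comm _ _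
  rw [c1, c2, t1, t2, t3, t4, t5, real_inner_comm (z 0), real_inner_comm (z (Fin.last m)),
    real_inner_comm (x 0) (x (Fin.last (m + 1)))]
  ring

/-- The energy identity for the update `z ↦ z + γ (x_{i+1} - x_i)`. -/
theorem IsSplitting.energy (h : IsSplitting z x a) (γ : ℝ) :
    ∑ i : Fin (m + 1), ‖z i + γ • (x i.succ - x i.castSucc)‖ ^ 2
      = ∑ i, ‖z i‖ ^ 2 - 2 * γ * ∑ i, ⟪x i, a i⟫_ℝ
        - γ * (1 - γ) * ∑ i : Fin (m + 1), ‖x i.succ - x i.castSucc‖ ^ 2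
        - γ * ‖x 0 - x (Fin.last (m + 1))‖ ^ 2 := by
  have h1 : ∀ i : Fin (m + 1), ‖z i + γ • (x i.succ - x i.castSucc)‖ ^ 2
      = ‖z i‖ ^ 2 - 2 * γ * ⟪z i, x i.castSucc - x i.succ⟫_ℝ
        + γ ^ 2 * ‖x i.succ - x i.castSucc‖ ^ 2 := by
    intro i
    rw [norm_add_sq_real, inner_smul_right, norm_smul, mul_pow, Real.norm_eq_abs, sq_abs,
      ← neg_sub (x i.castSucc) (x i.succ), inner_neg_right, norm_neg]
    ring
  simp only [h1, Finset.sum_add_distrib, Finset.sum_sub_distrib, ← Finset.mul_sum]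
  rw [h.sum_inner]
  ring

/-- The linear estimates behind `R`-linear convergence. Applied to the difference of two steps of
the splitting scheme, with all operators monotone, all but the last one Lipschitz continuous and
the last one strongly monotone, they say that the update is a contraction, and that the resolvent
values and operator values depend in a Lipschitz continuous way on the governing point. -/
theorem IsSplitting.exists_contraction (m : ℕ) (γ L μ : ℝ) (hγ₀ : 0 < γ) (hγ₁ : γ < 1)
    (hL : 0 ≤ L) (hμ : 0 < μ) :
    ∃ ρ K : ℝ, 0 ≤ ρ ∧ ρ < 1 ∧ 0 ≤ K ∧
      ∀ {E : Type*} [NormedAddCommGroup E] [InnerProductSpace ℝ E] {z : Fin (m + 1) → E}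
        {x a : Fin (m + 2) → E}, IsSplitting z x a →
        (∀ i : Fin (m + 1), ‖a i.castSucc‖ ≤ L * ‖x i.castSucc‖) →
        (∀ i : Fin (m + 1), 0 ≤ ⟪x i.castSucc, a i.castSucc⟫_ℝ) →
        (μ * ‖x (Fin.last (m + 1))‖ ^ 2 ≤ ⟪x (Fin.last (m + 1)), a (Fin.last (m + 1))⟫_ℝ) →
        Real.sqrt (∑ i : Fin (m + 1), ‖z i + γ • (x i.succ - x i.castSucc)‖ ^ 2)
          ≤ ρ * Real.sqrt (∑ i, ‖z i‖ ^ 2) ∧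
        ∀ i, ‖x i‖ ≤ K * Real.sqrt (∑ i, ‖z i‖ ^ 2) ∧
          ‖a i‖ ≤ K * Real.sqrt (∑ i, ‖z i‖ ^ 2) := by
  set κ : ℝ := min (2 * γ * μ) (γ * (1 - γ)) with hκ
  have hγ₂ : 0 < 1 - γ := sub_pos.2 hγ₁
  have hκ0 : 0 < κ := lt_min (by positivity) (by positivity)
  set M : ℝ := (m + 1) * ((m + 1) * ((2 + L) * (m + 2))) ^ 2 + κ with hM
  have hM0 : 0 < M := by positivity
  have hκM : κ / M ≤ 1 := by
    rw [div_le_one hM0, hM, le_add_iff_nonneg_left]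
    positivity
  set K : ℝ := (m + 2) / Real.sqrt κ with hK
  have hK0 : 0 ≤ K := by positivity
  refine ⟨Real.sqrt (1 - κ / M), 3 * K + 2, Real.sqrt_nonneg _, ?_, by positivity, ?_⟩
  · rw [Real.sqrt_lt' one_pos]
    have : 0 < κ / M := by positivity
    linarith
  intro E _ _ z x a h ha hmon hstrong
  set S : ℝ := ∑ i, ‖z i‖ ^ 2 with hS
  set D : ℝ := ∑ i : Fin (m + 1), ‖x i.succ - x i.castSucc‖ ^ 2 with hD
  set Q : ℝ := ‖x (Fin.last (m + 1))‖ ^ 2 + D with hQ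
  have hD0 : 0 ≤ D := Finset.sum_nonneg fun _ _ => sq_nonneg _
  have hQ0 : 0 ≤ Q := by positivity
  -- The energy identity gives decrease by a multiple of `Q`.
  have hdec : ∑ i : Fin (m + 1), ‖z i + γ • (x i.succ - x i.castSucc)‖ ^ 2 ≤ S - κ * Q := by
    rw [h.energy γ, Fin.sum_univ_castSucc (f := fun i => ⟪x i, a i⟫_ℝ)]
    have h1 : 0 ≤ ∑ i : Fin (m + 1), ⟪x i.castSucc, a i.castSucc⟫_ℝ :=
      Finset.sum_nonneg fun i _ => hmon i
    have h2 : κ * ‖x (Fin.last (m + 1))‖ ^ 2 ≤ 2 * γ * (μ * ‖x (Fin.last (m + 1))‖ ^ 2) := by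
      rw [← mul_assoc]
      exact mul_le_mul_of_nonneg_right (min_le_left _ _) (sq_nonneg _)
    have h3 : κ * D ≤ γ * (1 - γ) * D := mul_le_mul_of_nonneg_right (min_le_right _ _) hD0
    have h4 : 0 ≤ γ * ‖x 0 - x (Fin.last (m + 1))‖ ^ 2 := by positivity
    have h5 := mul_le_mul_of_nonneg_left hstrong (by positivity : 0 ≤ 2 * γ)
    have h6 : 0 ≤ 2 * γ * ∑ i : Fin (m + 1), ⟪x i.castSucc, a i.castSucc⟫_ℝ := by positivity
    rw [hQ, mul_add κ, mul_add (2 * γ)]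
    linarith
  have hx : ∀ i, ‖x i‖ ≤ (m + 2) * Real.sqrt Q := by
    refine norm_le_of_norm_last_le (Real.le_sqrt_of_sq_le ?_) fun i => Real.le_sqrt_of_sq_le ?_
    · linarith
    · have := Finset.single_le_sum (f := fun i : Fin (m + 1) => ‖x i.succ - x i.castSucc‖ ^ 2)
        (fun _ _ => sq_nonneg _) (Finset.mem_univ i)
      have h0 := sq_nonneg ‖x (Fin.last (m + 1))‖
      linarith
  have hSQ : S ≤ M * Q := by
    have h1 : S ≤ ∑ _i : Fin (m + 1), ((m + 1) * ((2 + L) * ((m + 2) * Real.sqrt Q))) ^ 2 :=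
      Finset.sum_le_sum fun i _ => pow_le_pow_left₀ (norm_nonneg _) (h.norm_le hL hx ha i) 2
    have h2 : ((m + 1) * ((2 + L) * ((m + 2) * Real.sqrt Q))) ^ 2
        = ((m + 1) * ((2 + L) * (m + 2))) ^ 2 * Q := by
      conv_rhs => rw [← Real.sq_sqrt hQ0]
      ring
    rw [Finset.sum_const, Finset.card_univ, Fintype.card_fin, h2, nsmul_eq_mul] at h1
    push_cast at h1
    have h3 : 0 ≤ κ * Q := by positivity
    rw [hM, add_mul]
    linarith
  have hκQ : κ * Q ≤ S := by
    have : 0 ≤ ∑ i : Fin (m + 1), ‖z i + γ • (x i.succ - x i.castSucc)‖ ^ 2 :=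
      Finset.sum_nonneg fun _ _ => sq_nonneg _
    linarith
  have hsqrt : Real.sqrt Q ≤ Real.sqrt S / Real.sqrt κ := by
    rw [← Real.sqrt_div' _ hκ0.le]
    refine Real.sqrt_le_sqrt ?_
    rw [le_div_iff₀ hκ0]
    linarith
  have hxK : ∀ i, ‖x i‖ ≤ K * Real.sqrt S := by
    intro i
    refine (hx i).trans ?_
    rw [hK, div_mul_eq_mul_div, mul_div_assoc]
    exact mul_le_mul_of_nonneg_left hsqrt (by positivity)
  have hzS : ∀ i, ‖z i‖ ≤ Real.sqrt S := fun i =>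
    Real.le_sqrt_of_sq_le (Finset.single_le_sum (f := fun i => ‖z i‖ ^ 2)
      (fun _ _ => sq_nonneg _) (Finset.mem_univ i))
  have hS0 := Real.sqrt_nonneg S
  have hKS : 0 ≤ K * Real.sqrt S := by positivity
  refine ⟨?_, fun i => ⟨by linarith [hxK i], ?_⟩⟩
  · rw [← Real.sqrt_mul (sub_nonneg.2 hκM)]
    refine Real.sqrt_le_sqrt (hdec.trans ?_)
    have : κ / M * S ≤ κ * Q := by
      rw [div_mul_eq_mul_div, div_le_iff₀ hM0]
      nlinarith
    linarith
  · induction i using Fin.cases with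
    | zero =>
      have h1 : a 0 = z 0 - x 0 := by rw [← h.first, add_sub_cancel_left]
      have h2 := norm_sub_le (z 0) (x 0)
      rw [← h1] at h2
      linarith [hzS 0, hxK 0]
    | succ j =>
      have h1 : a j.succ = splittingInput z x j - x j.succ := by
        rw [← h.next, add_sub_cancel_left]
      rw [h1]
      induction j using Fin.lastCases with
      | last =>
        rw [splittingInput_last]
        have h2 := norm_sub_le (x 0 + x (Fin.last m).castSucc - z (Fin.last m))
          (x (Fin.last m).succ)
        have h3 := norm_sub_le (x 0 + x (Fin.last m).castSucc) (z (Fin.last m))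
        have h4 := norm_add_le (x 0) (x (Fin.last m).castSucc)
        linarith [hzS (Fin.last m), hxK 0, hxK (Fin.last m).castSucc, hxK (Fin.last m).succ]
      | cast i =>
        rw [splittingInput_castSucc]
        have h2 := norm_sub_le (z i.succ + x i.castSucc.castSucc - z i.castSucc) (x i.castSucc.succ)
        have h3 := norm_sub_le (z i.succ + x i.castSucc.castSucc) (z i.castSucc)
        have h4 := norm_add_le (z i.succ) (x i.castSucc.castSucc)
        linarith [hzS i.succ, hzS i.castSucc, hxK i.castSucc.castSucc, hxK i.castSucc.succ]

end Splitting

/-! ### Steps of the primal-dual scheme -/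

section Step

variable {H₁ H₂ : Type*}
  [NormedAddCommGroup H₁] [InnerProductSpace ℝ H₁] [CompleteSpace H₁]
  [NormedAddCommGroup H₂] [InnerProductSpace ℝ H₂] [CompleteSpace H₂]
  {m : ℕ}

/-- The operator `Id + C* C` is boundedly invertible, by the Lax–Milgram theorem. -/
theorem isInvertible_id_add_adjoint_comp (C : H₁ →L[ℝ] H₂) :
    (ContinuousLinearMap.id ℝ H₁ + ContinuousLinearMap.adjoint C ∘L C).IsInvertible := by
  set T := ContinuousLinearMap.id ℝ H₁ + ContinuousLinearMap.adjoint C ∘L C with hT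
  have hco : IsCoercive ((innerSL ℝ : H₁ →L[ℝ] H₁ →L[ℝ] ℝ) ∘L T) := by
    refine ⟨1, one_pos, fun u => ?_⟩
    have h1 : ⟪T u, u⟫_ℝ = ‖u‖ ^ 2 + ‖C u‖ ^ 2 := by
      simp [hT, inner_add_left, ContinuousLinearMap.adjoint_inner_left]
    change 1 * ‖u‖ * ‖u‖ ≤ ⟪T u, u⟫_ℝ
    rw [h1]
    nlinarith [sq_nonneg ‖C u‖]
  refine ⟨hco.continuousLinearEquivOfBilin, ?_⟩
  ext u
  refine ext_inner_right ℝ fun w => ?_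
  exact hco.continuousLinearEquivOfBilin_apply u w

/-- One step of the primal-dual scheme at the governing point `(p, q)`, described without
resolvents: `(u i, v i)` are the resolvent values, `b j` is the subgradient of `f_j` at
`u_{j+1}` and `w j` the subgradient of the conjugate of `g_j` at `v_{j+1}` that the resolvents
select; the latter is expressed by `v j.succ ∈ ∂ g_j (w j)`. -/
structure IsPrimalDualStep (C : H₁ →L[ℝ] H₂) (f : Fin (m + 1) → H₁ → EReal)
    (g : Fin (m + 1) → H₂ → EReal) (p : Fin (m + 1) → H₁) (q : Fin (m + 1) → H₂)
    (u : Fin (m + 2) → H₁) (v : Fin (m + 2) → H₂) (b : Fin (m + 1) → H₁)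
    (w : Fin (m + 1) → H₂) : Prop where
  primal : IsSplitting p u (Fin.cons (α := fun _ => H₁) (ContinuousLinearMap.adjoint C (v 0)) b)
  dual : IsSplitting q v (Fin.cons (α := fun _ => H₂) (-C (u 0)) w)
  mem_f : ∀ j, b j ∈ subdifferential (f j) (u j.succ)
  mem_g : ∀ j, v j.succ ∈ subdifferential (g j) (w j)

variable {α β : ℝ≥0} {σ τ : ℝ} {f : Fin (m + 1) → H₁ → EReal} {g : Fin (m + 1) → H₂ → EReal}

theorem StandingAssumption.isClosedConvex_f (hσ : 0 < σ) (h : StandingAssumption α β σ τ f g)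
    (j : Fin (m + 1)) : IsClosedConvex 0 (f j) := by
  induction j using Fin.lastCases with
  | last => exact h.f_last.isClosedConvex.mono hσ.le
  | cast i => exact (h.f_smooth i).isClosedConvex

theorem StandingAssumption.isClosedConvex_g (hτ : 0 < τ) (h : StandingAssumption α β σ τ f g)
    (j : Fin (m + 1)) : IsClosedConvex 0 (g j) := by
  induction j using Fin.lastCases with
  | last => exact h.g_last.isClosedConvex
  | cast i => exact (h.g_strong i).isClosedConvex.mono hτ.le

theorem StandingAssumption.mem_opMiddle_iff (hτ : 0 < τ) (h : StandingAssumption α β σ τ f g)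
    (i : Fin m) (x a : H₁ × H₂) : a ∈ opMiddle f g i x ↔
      a.1 ∈ subdifferential (f i.castSucc) x.1 ∧ x.2 ∈ subdifferential (g i.castSucc) a.2 := by
  have hg := (h.g_strong i).isClosedConvex
  rw [opMiddle, Set.mem_singleton_iff, Prod.ext_iff]
  refine and_congr ⟨fun h1 => ?_, fun h1 => (h.f_smooth i).eq_grad h1⟩
    ⟨fun h1 => ?_, fun h1 => (hg.grad_conj hτ h1).symm⟩
  · rw [h1]
    exact (h.f_smooth i).grad_mem_subdifferential _
  · obtain ⟨w, hw⟩ := hg.exists_mem_subdifferential hτ x.2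
    rw [h1]
    simpa only [hg.grad_conj hτ hw] using hw

theorem StandingAssumption.mem_opLast_iff (h : StandingAssumption α β σ τ f g)
    (x a : H₁ × H₂) : a ∈ opLast f g x ↔
      a.1 ∈ subdifferential (f (Fin.last m)) x.1 ∧ x.2 ∈ subdifferential (g (Fin.last m)) a.2 :=
  and_congr Iff.rfl ⟨fun h1 => h.g_last.mem_subdifferential_of_conj h1,
    fun h1 => mem_subdifferential_conj h.g_last.proper h1⟩

theorem sub_sub_prox_mem {F : H₂ → EReal} (hF : IsClosedConvex 0 F) {q v : H₂}
    (hv : v = q - prox F q) : v ∈ subdifferential F (q - v) := by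
  rw [hv, sub_sub_cancel]
  exact hF.sub_prox_mem q

theorem first_equations_iff (C : H₁ →L[ℝ] H₂) (u p : H₁) (v q : H₂) :
    (u = (ContinuousLinearMap.id ℝ H₁ + ContinuousLinearMap.adjoint C ∘L C).inverse
        (p - ContinuousLinearMap.adjoint C q) ∧ v = q + C u) ↔
      u + ContinuousLinearMap.adjoint C v = p ∧ v + -C u = q := by
  rw [eq_comm (a := u), (isInvertible_id_add_adjoint_comp C).inverse_apply_eq]
  simp only [add_apply, ContinuousLinearMap.id_apply,
    ContinuousLinearMap.comp_apply]
  constructor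
  · rintro ⟨h1, rfl⟩
    rw [map_add]
    refine ⟨?_, by abel⟩
    rw [add_comm (ContinuousLinearMap.adjoint C q), ← add_assoc, ← h1, sub_add_cancel]
  · rintro ⟨rfl, rfl⟩
    simp only [map_add, map_neg]
    exact ⟨by abel, by abel⟩

/-- The sequences of the algorithm consist of steps of the primal-dual scheme. -/
theorem IsGenerated.isPrimalDualStep (hσ : 0 < σ) (hτ : 0 < τ)
    (h : StandingAssumption α β σ τ f g) {γ : ℝ} {C : H₁ →L[ℝ] H₂} {p : ℕ → Fin (m + 1) → H₁}
    {q : ℕ → Fin (m + 1) → H₂} {u : ℕ → Fin (m + 2) → H₁} {v : ℕ → Fin (m + 2) → H₂}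
    (hgen : IsGenerated γ C f g p q u v) (k : ℕ) :
    IsPrimalDualStep C f g (p k) (q k) (u k) (v k)
      (fun j => splittingInput (p k) (u k) j - u k j.succ)
      (fun j => splittingInput (q k) (v k) j - v k j.succ) := by
  have h0 := (first_equations_iff C _ _ _ _).1 ⟨hgen.u_first k, hgen.v_first k⟩
  refine ⟨⟨h0.1, fun j => ?_⟩, ⟨h0.2, fun j => ?_⟩, fun j => ?_, fun j => ?_⟩
  · simp
  · simp
  · have h1 : u k j.succ = prox (f j) (splittingInput (p k) (u k) j) := by
      induction j using Fin.lastCases with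
      | last => simpa using hgen.u_last k
      | cast i => simpa using hgen.u_middle k i
    rw [h1]
    exact (h.isClosedConvex_f hσ j).sub_prox_mem _
  · refine sub_sub_prox_mem (h.isClosedConvex_g hτ j) ?_
    induction j using Fin.lastCases with
    | last => simpa using hgen.v_last k
    | cast i => simpa using hgen.v_middle k i

theorem sub_resolvent_mem {E : Type*} [AddCommGroup E] {A : E → Set E} {z : E}
    (h : ∃ y, z - y ∈ A y) : z - resolvent A z ∈ A (resolvent A z) :=
  Classical.epsilon_spec h

/-- The fixed point operator performs a step of the primal-dual scheme. -/
theorem exists_isPrimalDualStep_fixedPointOperator (hσ : 0 < σ) (hτ : 0 < τ)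
    (h : StandingAssumption α β σ τ f g) (γ : ℝ) (C : H₁ →L[ℝ] H₂)
    (pq : (Fin (m + 1) → H₁) × (Fin (m + 1) → H₂)) :
    ∃ u v b w, IsPrimalDualStep C f g pq.1 pq.2 u v b w ∧
      fixedPointOperator γ C f g pq = (fun i => pq.1 i + γ • (u i.succ - u i.castSucc),
        fun i => pq.2 i + γ • (v i.succ - v i.castSucc)) := by
  set z : Fin (m + 1) → H₁ × H₂ := fun i => (pq.1 i, pq.2 i) with hz
  set x := splittingPoint (opFirst C) (opMiddle f g) (opLast f g) z with hx
  have hhead : ∀ i : Fin (m + 1),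
      x i.castSucc = splittingHead (opFirst C) (opMiddle f g) z i := fun i => by
    rw [hx, splittingPoint, Fin.snoc_castSucc]
  have hprox : ∀ (j : Fin (m + 1)) (y : H₁ × H₂), ∃ x : H₁ × H₂,
      (y - x).1 ∈ subdifferential (f j) x.1 ∧ x.2 ∈ subdifferential (g j) (y - x).2 :=
    fun j y => ⟨(prox (f j) y.1, y.2 - prox (g j) y.2),
      (h.isClosedConvex_f hσ j).sub_prox_mem _, sub_sub_prox_mem (h.isClosedConvex_g hτ j) rfl⟩
  have h0 : z 0 - x 0 ∈ opFirst C (x 0) := by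
    have hx0 : x 0 = resolvent (opFirst C) (z 0) := by
      rw [← Fin.castSucc_zero, hhead]
      rfl
    rw [hx0]
    refine sub_resolvent_mem ?_
    set u := (ContinuousLinearMap.id ℝ H₁ + ContinuousLinearMap.adjoint C ∘L C).inverse
        ((z 0).1 - ContinuousLinearMap.adjoint C (z 0).2) with hu
    have h1 := (first_equations_iff C u (z 0).1 ((z 0).2 + C u) (z 0).2).1 ⟨rfl, rfl⟩
    refine ⟨(u, (z 0).2 + C u), ?_⟩
    rw [opFirst, Set.mem_singleton_iff, Prod.ext_iff]
    exact ⟨sub_eq_of_eq_add' h1.1.symm, sub_eq_of_eq_add' h1.2.symm⟩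
  have hmem : ∀ j : Fin (m + 1),
      (splittingInput z x j - x j.succ).1 ∈ subdifferential (f j) (x j.succ).1 ∧
      (x j.succ).2 ∈ subdifferential (g j) (splittingInput z x j - x j.succ).2 := by
    intro j
    induction j using Fin.lastCases with
    | last =>
      have h1 : x (Fin.last m).succ
          = resolvent (opLast f g) (splittingInput z x (Fin.last m)) := by
        rw [splittingInput_last, ← Fin.castSucc_zero, hhead, hhead, hx, splittingPoint,
          Fin.succ_last, Fin.snoc_last]
      rw [h1, ← h.mem_opLast_iff]
      refine sub_resolvent_mem ?_
      simp only [h.mem_opLast_iff]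
      exact hprox _ _
    | cast i =>
      have h1 : x i.castSucc.succ
          = resolvent (opMiddle f g i) (splittingInput z x i.castSucc) := by
        rw [splittingInput_castSucc, hhead, Fin.succ_castSucc, hhead, splittingHead,
          Fin.induction_succ]
      rw [h1, ← h.mem_opMiddle_iff hτ]
      refine sub_resolvent_mem ?_
      simp only [h.mem_opMiddle_iff hτ]
      exact hprox _ _
  rw [opFirst, Set.mem_singleton_iff, Prod.ext_iff] at h0
  refine ⟨fun i => (x i).1, fun i => (x i).2, fun j => (splittingInput z x j - x j.succ).1,
    fun j => (splittingInput z x j - x j.succ).2, ⟨⟨?_, fun j => ?_⟩, ⟨?_, fun j => ?_⟩,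
    fun j => (hmem j).1, fun j => (hmem j).2⟩, rfl⟩
  · exact (congrArg ((x 0).1 + ·) h0.1).symm.trans (add_sub_cancel _ _)
  · rw [Fin.cons_succ]
    exact (add_sub_cancel _ _).trans (splittingInput_map (AddMonoidHom.fst H₁ H₂) z x j).symm
  · exact (congrArg ((x 0).2 + ·) h0.2).symm.trans (add_sub_cancel _ _)
  · rw [Fin.cons_succ]
    exact (add_sub_cancel _ _).trans (splittingInput_map (AddMonoidHom.snd H₁ H₂) z x j).symm

end Step

/-! ### Contraction in the product space -/

section Contraction

theorem IsSplitting.prod {E F : Type*} [AddCommGroup E] [AddCommGroup F] {m : ℕ}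
    {z : Fin (m + 1) → E} {z' : Fin (m + 1) → F} {x a : Fin (m + 2) → E} {x' a' : Fin (m + 2) → F}
    (h : IsSplitting z x a) (h' : IsSplitting z' x' a') :
    IsSplitting (fun i => WithLp.toLp 2 (z i, z' i)) (fun i => WithLp.toLp 2 (x i, x' i))
      (fun i => WithLp.toLp 2 (a i, a' i)) := by
  refine ⟨?_, fun j => ?_⟩
  · rw [← WithLp.toLp_add, Prod.mk_add_mk, h.first, h'.first]
  · have h1 : splittingInput (fun i => WithLp.toLp 2 (z i, z' i))
        (fun i => WithLp.toLp 2 (x i, x' i)) j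
        = WithLp.toLp 2 (splittingInput z x j, splittingInput z' x' j) := by
      induction j using Fin.lastCases <;>
        simp only [splittingInput_castSucc, splittingInput_last, ← WithLp.toLp_add,
          ← WithLp.toLp_sub, Prod.mk_add_mk, Prod.mk_sub_mk]
    rw [h1, ← WithLp.toLp_add, Prod.mk_add_mk, h.next, h'.next]

variable {H₁ H₂ : Type*} [NormedAddCommGroup H₁] [NormedAddCommGroup H₂] {m : ℕ}

theorem norm_toLp_prod_sq (x : H₁) (y : H₂) :
    ‖WithLp.toLp 2 (x, y)‖ ^ 2 = ‖x‖ ^ 2 + ‖y‖ ^ 2 :=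
  WithLp.prod_norm_sq_eq_of_L2 _

theorem norm_toLp_prod_le {a : H₁} {b : H₂} {L r s : ℝ} (hL : 0 ≤ L)
    (ha : ‖a‖ ≤ L * r) (hb : ‖b‖ ≤ L * s) {x : WithLp 2 (H₁ × H₂)}
    (hx : ‖x‖ ^ 2 = r ^ 2 + s ^ 2) : ‖WithLp.toLp 2 (a, b)‖ ≤ L * ‖x‖ := by
  rw [← pow_le_pow_iff_left₀ (norm_nonneg _) (by positivity) two_ne_zero, norm_toLp_prod_sq,
    mul_pow, hx]
  have h1 := pow_le_pow_left₀ (norm_nonneg _) ha 2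
  have h2 := pow_le_pow_left₀ (norm_nonneg _) hb 2
  linarith

theorem norm_fst_le_norm_toLp (x : H₁) (y : H₂) : ‖x‖ ≤ ‖WithLp.toLp 2 (x, y)‖ := by
  rw [← pow_le_pow_iff_left₀ (norm_nonneg _) (norm_nonneg _) two_ne_zero, norm_toLp_prod_sq]
  linarith [sq_nonneg ‖y‖]

theorem norm_snd_le_norm_toLp (x : H₁) (y : H₂) : ‖y‖ ≤ ‖WithLp.toLp 2 (x, y)‖ := by
  rw [← pow_le_pow_iff_left₀ (norm_nonneg _) (norm_nonneg _) two_ne_zero, norm_toLp_prod_sq]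
  linarith [sq_nonneg ‖x‖]

/-- The point `(p, q)` of the Hilbert space `H₁ ^ (n - 1) × H₂ ^ (n - 1)`. -/
abbrev toPair (p : Fin (m + 1) → H₁) (q : Fin (m + 1) → H₂) :
    WithLp 2 (WithLp 2 (Fin (m + 1) → H₁) × WithLp 2 (Fin (m + 1) → H₂)) :=
  WithLp.toLp 2 (WithLp.toLp 2 p, WithLp.toLp 2 q)

theorem sqrt_sum_norm_toLp_sq (p : Fin (m + 1) → H₁) (q : Fin (m + 1) → H₂) :
    Real.sqrt (∑ i, ‖WithLp.toLp 2 (p i, q i)‖ ^ 2) = ‖toPair p q‖ := by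
  rw [← Real.sqrt_sq (norm_nonneg (toPair p q)), WithLp.prod_norm_sq_eq_of_L2,
    PiLp.norm_sq_eq_of_L2, PiLp.norm_sq_eq_of_L2, ← Finset.sum_add_distrib]
  simp only [norm_toLp_prod_sq]
  rfl

variable [InnerProductSpace ℝ H₁] [InnerProductSpace ℝ H₂] [CompleteSpace H₁] [CompleteSpace H₂]
  {α β : ℝ≥0} {σ τ : ℝ}
  {f : Fin (m + 1) → H₁ → EReal} {g : Fin (m + 1) → H₂ → EReal}

/-- Two steps of the primal-dual scheme at different points: the update is a contraction, and all
auxiliary points and subgradients depend in a Lipschitz continuous way on the governing point. -/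
theorem StandingAssumption.exists_contraction (hσ : 0 < σ) (hτ : 0 < τ)
    (h : StandingAssumption α β σ τ f g) {γ : ℝ} (hγ₀ : 0 < γ) (hγ₁ : γ < 1) (C : H₁ →L[ℝ] H₂) :
    ∃ ρ K : ℝ, 0 ≤ ρ ∧ ρ < 1 ∧ 0 ≤ K ∧ ∀ {p q u v b w p' q' u' v' b' w'},
      IsPrimalDualStep C f g p q u v b w → IsPrimalDualStep C f g p' q' u' v' b' w' →
      ‖toPair (fun i => p i + γ • (u i.succ - u i.castSucc))
          (fun i => q i + γ • (v i.succ - v i.castSucc))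
        - toPair (fun i => p' i + γ • (u' i.succ - u' i.castSucc))
          (fun i => q' i + γ • (v' i.succ - v' i.castSucc))‖
        ≤ ρ * ‖toPair p q - toPair p' q'‖ ∧
      (∀ i, ‖u i - u' i‖ ≤ K * ‖toPair p q - toPair p' q'‖ ∧
        ‖v i - v' i‖ ≤ K * ‖toPair p q - toPair p' q'‖) ∧
      ∀ j, ‖b j - b' j‖ ≤ K * ‖toPair p q - toPair p' q'‖ ∧
        ‖w j - w' j‖ ≤ K * ‖toPair p q - toPair p' q'‖ := by
  have hL1 : (0 : ℝ) ≤ ‖C‖ := norm_nonneg _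
  have hL2 : (0 : ℝ) ≤ α := α.2
  have hL3 : (0 : ℝ) ≤ τ⁻¹ := by positivity
  set L : ℝ := ‖C‖ + α + τ⁻¹ with hL
  have hL0 : 0 ≤ L := by positivity
  set μ : ℝ := min σ (1 / (2 * ((β : ℝ) + 1))) with hμ
  have hμ0 : 0 < μ := lt_min hσ (by have : (0 : ℝ) ≤ β := β.2; positivity)
  obtain ⟨ρ, K, hρ0, hρ1, hK, H⟩ := IsSplitting.exists_contraction m γ L μ hγ₀ hγ₁ hL0 hμ0
  refine ⟨ρ, K, hρ0, hρ1, hK, ?_⟩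
  intro p q u v b w p' q' u' v' b' w' s s'
  have hmonoL : ∀ {l r : ℝ}, l ≤ L → 0 ≤ r → l * r ≤ L * r := fun h h' =>
    mul_le_mul_of_nonneg_right h h'
  have hsplit := (s.primal.sub s'.primal).prod (s.dual.sub s'.dual)
  -- Differences of the smooth operators are bounded by differences of the points.
  have hlip : ∀ i : Fin m, ‖b i.castSucc - b' i.castSucc‖
        ≤ L * ‖u i.castSucc.succ - u' i.castSucc.succ‖ ∧
      ‖w i.castSucc - w' i.castSucc‖ ≤ L * ‖v i.castSucc.succ - v' i.castSucc.succ‖ := by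
    intro i
    constructor
    · rw [(h.f_smooth i).eq_grad (s.mem_f i.castSucc), (h.f_smooth i).eq_grad (s'.mem_f i.castSucc)]
      exact ((h.f_smooth i).norm_grad_sub_le _ _).trans (hmonoL (by linarith) (norm_nonneg _))
    · exact ((h.g_strong i).isClosedConvex.norm_sub_le_of_mem_subdifferential hτ
        (s.mem_g i.castSucc) (s'.mem_g i.castSucc)).trans (hmonoL (by linarith) (norm_nonneg _))
  have hmon : ∀ j : Fin (m + 1), 0 ≤ ⟪u j.succ - u' j.succ, b j - b' j⟫_ℝ ∧
      0 ≤ ⟪v j.succ - v' j.succ, w j - w' j⟫_ℝ := by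
    intro j
    have hf := h.isClosedConvex_f hσ j
    have hg := h.isClosedConvex_g hτ j
    have h1 := hf.subgradientGrowth.strong_monotone hf.proper.1 (s.mem_f j) (s'.mem_f j)
    have h2 := hg.subgradientGrowth.strong_monotone hg.proper.1 (s.mem_g j) (s'.mem_g j)
    rw [zero_mul] at h1 h2
    rw [real_inner_comm] at h2
    exact ⟨h1, h2⟩
  have hres := H hsplit ?_ ?_ ?_
  · obtain ⟨h1, h2⟩ := hres
    have hN : Real.sqrt (∑ i, ‖WithLp.toLp 2 (p i - p' i, q i - q' i)‖ ^ 2)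
        = ‖toPair p q - toPair p' q'‖ := sqrt_sum_norm_toLp_sq _ _
    have hN' : Real.sqrt (∑ i : Fin (m + 1), ‖WithLp.toLp 2 (p i - p' i, q i - q' i)
          + γ • (WithLp.toLp 2 (u i.succ - u' i.succ, v i.succ - v' i.succ)
            - WithLp.toLp 2 (u i.castSucc - u' i.castSucc, v i.castSucc - v' i.castSucc))‖ ^ 2)
        = ‖toPair (fun i => p i + γ • (u i.succ - u i.castSucc))
          (fun i => q i + γ • (v i.succ - v i.castSucc))
        - toPair (fun i => p' i + γ • (u' i.succ - u' i.castSucc))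
          (fun i => q' i + γ • (v' i.succ - v' i.castSucc))‖ := by
      refine Eq.trans ?_ (sqrt_sum_norm_toLp_sq _ _)
      congr 1
      refine Finset.sum_congr rfl fun i _ => ?_
      congr 2
      rw [← WithLp.toLp_sub, ← WithLp.toLp_smul, ← WithLp.toLp_add]
      congr 1
      refine Prod.ext ?_ ?_
      · change p i - p' i + γ • (u i.succ - u' i.succ - (u i.castSucc - u' i.castSucc))
          = p i + γ • (u i.succ - u i.castSucc) - (p' i + γ • (u' i.succ - u' i.castSucc))
        module
      · change q i - q' i + γ • (v i.succ - v' i.succ - (v i.castSucc - v' i.castSucc))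
          = q i + γ • (v i.succ - v i.castSucc) - (q' i + γ • (v' i.succ - v' i.castSucc))
        module
    rw [hN, hN'] at h1
    simp only [hN] at h2
    refine ⟨h1, fun i => ⟨(norm_fst_le_norm_toLp _ _).trans (h2 i).1,
      (norm_snd_le_norm_toLp _ _).trans (h2 i).1⟩, fun j => ?_⟩
    have h3 := (h2 j.succ).2
    simp only [Fin.cons_succ] at h3
    exact ⟨(norm_fst_le_norm_toLp _ _).trans h3, (norm_snd_le_norm_toLp _ _).trans h3⟩
  · intro i
    induction i using Fin.cases with
    | zero =>
      simp only [Fin.castSucc_zero, Fin.cons_zero]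
      refine norm_toLp_prod_le hL0 (r := ‖v 0 - v' 0‖) (s := ‖u 0 - u' 0‖) ?_ ?_ ?_
      · rw [← map_sub]
        refine (ContinuousLinearMap.le_opNorm _ _).trans (hmonoL ?_ (norm_nonneg _))
        rw [LinearIsometryEquiv.norm_map]
        linarith
      · rw [neg_sub_neg, ← map_sub, norm_sub_rev (u 0)]
        exact (ContinuousLinearMap.le_opNorm _ _).trans (hmonoL (by linarith) (norm_nonneg _))
      · rw [norm_toLp_prod_sq, add_comm]
    | succ i =>
      simp only [← Fin.succ_castSucc, Fin.cons_succ]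
      exact norm_toLp_prod_le hL0 (hlip i).1 (hlip i).2 (norm_toLp_prod_sq _ _)
  · intro i
    rw [WithLp.prod_inner_apply]
    induction i using Fin.cases with
    | zero =>
      simp only [Fin.castSucc_zero, Fin.cons_zero, ← map_sub, neg_sub_neg,
        ContinuousLinearMap.adjoint_inner_right]
      rw [← neg_sub (u 0) (u' 0), map_neg, inner_neg_right, real_inner_comm, add_neg_cancel]
    | succ i =>
      simp only [← Fin.succ_castSucc, Fin.cons_succ]
      exact add_nonneg (hmon i.castSucc).1 (hmon i.castSucc).2
  · rw [WithLp.prod_inner_apply, norm_toLp_prod_sq, mul_add]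
    simp only [← Fin.succ_last, Fin.cons_succ]
    have hf := h.f_last.isClosedConvex
    have hg := h.g_last
    have h1 := hf.subgradientGrowth.strong_monotone hf.proper.1 (s.mem_f (Fin.last m))
      (s'.mem_f (Fin.last m))
    have h2 := hg.subgradientGrowth_conj.strong_monotone (conj_ne_bot hg.proper)
      (mem_subdifferential_conj hg.proper (s.mem_g (Fin.last m)))
      (mem_subdifferential_conj hg.proper (s'.mem_g (Fin.last m)))
    exact add_le_add
      ((mul_le_mul_of_nonneg_right (min_le_left _ _) (sq_nonneg _)).trans h1)
      ((mul_le_mul_of_nonneg_right (min_le_right _ _) (sq_nonneg _)).trans h2)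

end Contraction

/-! ### Optimality conditions, quadratic growth and the gap -/

section Optimality

theorem coe_finset_sum {ι : Type*} (s : Finset ι) (φ : ι → ℝ) :
    ((∑ i ∈ s, φ i : ℝ) : EReal) = ∑ i ∈ s, (φ i : EReal) :=
  map_sum (⟨⟨Real.toEReal, EReal.coe_zero⟩, EReal.coe_add⟩ : ℝ →+ EReal) φ s

theorem sum_eq_coe {ι : Type*} [Fintype ι] {F : ι → EReal} {φ : ι → ℝ}
    (h : ∀ i, F i = φ i) : ∑ i, F i = ((∑ i, φ i : ℝ) : EReal) := by
  rw [coe_finset_sum]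
  exact Finset.sum_congr rfl fun i _ => h i

theorem coe_sum_le {ι : Type*} [Fintype ι] {F : ι → EReal} {φ : ι → ℝ}
    (h : ∀ i, (φ i : EReal) ≤ F i) : ((∑ i, φ i : ℝ) : EReal) ≤ ∑ i, F i := by
  rw [coe_finset_sum]
  exact Finset.sum_le_sum fun i _ => h i

theorem infConv_le {H ι : Type*} [NormedAddCommGroup H] [InnerProductSpace ℝ H] [Fintype ι]
    (F : ι → H → EReal) {x : H} {w : ι → H} (h : x = ∑ i, w i) :
    infConv F x ≤ ∑ i, F i (w i) :=
  iInf₂_le w h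

theorem le_infConv {H ι : Type*} [NormedAddCommGroup H] [InnerProductSpace ℝ H] [Fintype ι]
    {F : ι → H → EReal} {x : H} {a : EReal}
    (h : ∀ w : ι → H, x = ∑ i, w i → a ≤ ∑ i, F i (w i)) : a ≤ infConv F x :=
  le_iInf₂ h

theorem isSolution_iff_of_growth {H : Type*} [NormedAddCommGroup H] [InnerProductSpace ℝ H]
    {F : H → EReal} {x : H} {c κ : ℝ} (hκ : 0 < κ) (hx : F x ≤ c)
    (hg : ∀ y, ((c + κ * ‖y - x‖ ^ 2 : ℝ) : EReal) ≤ F y) (y : H) :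
    IsSolution F y ↔ y = x := by
  constructor
  · intro h
    have h1 := (hg y).trans ((h x).trans hx)
    norm_cast at h1
    have h2 : ‖y - x‖ ^ 2 = 0 := by
      refine le_antisymm ?_ (sq_nonneg _)
      by_contra! h3
      have := mul_pos hκ h3
      linarith
    exact sub_eq_zero.1 (norm_eq_zero.1 (pow_eq_zero_iff two_ne_zero |>.1 h2))
  · rintro rfl z
    refine hx.trans (le_trans ?_ (hg z))
    norm_cast
    have : 0 ≤ κ * ‖z - y‖ ^ 2 := by positivity
    linarith

variable {H₁ H₂ : Type*}
  [NormedAddCommGroup H₁] [InnerProductSpace ℝ H₁] [CompleteSpace H₁]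
  [NormedAddCommGroup H₂] [InnerProductSpace ℝ H₂] [CompleteSpace H₂]
  {m : ℕ}

/-- The optimality conditions `-C* v = ∑ b_j` and `C u = ∑ w_j` with `b_j ∈ ∂ f_j (u)` and
`w_j ∈ ∂ g_j* (v)`; the latter is expressed by `v ∈ ∂ g_j (w_j)`. -/
structure IsKKTPoint (C : H₁ →L[ℝ] H₂) (f : Fin (m + 1) → H₁ → EReal)
    (g : Fin (m + 1) → H₂ → EReal) (u : H₁) (v : H₂) (b : Fin (m + 1) → H₁)
    (w : Fin (m + 1) → H₂) : Prop where
  mem_f : ∀ j, b j ∈ subdifferential (f j) u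
  mem_g : ∀ j, v ∈ subdifferential (g j) (w j)
  sum_b : -(ContinuousLinearMap.adjoint C v) = ∑ j, b j
  sum_w : C u = ∑ j, w j

/-- At a step that does not move, all resolvent values coincide and satisfy the optimality
conditions. -/
theorem IsPrimalDualStep.isKKTPoint {C : H₁ →L[ℝ] H₂} {f : Fin (m + 1) → H₁ → EReal}
    {g : Fin (m + 1) → H₂ → EReal} {p q u v b w} (s : IsPrimalDualStep C f g p q u v b w)
    (hu : ∀ i : Fin (m + 1), u i.succ = u i.castSucc)
    (hv : ∀ i : Fin (m + 1), v i.succ = v i.castSucc) :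
    (∀ i, u i = u 0) ∧ (∀ i, v i = v 0) ∧ IsKKTPoint C f g (u 0) (v 0) b w := by
  have hu0 : ∀ i, u i = u 0 := fun i => by
    induction i using Fin.induction with
    | zero => rfl
    | succ i ih => rw [hu, ih]
  have hv0 : ∀ i, v i = v 0 := fun i => by
    induction i using Fin.induction with
    | zero => rfl
    | succ i ih => rw [hv, ih]
  have h1 := s.primal.sum_eq
  have h2 := s.dual.sum_eq
  rw [Fin.sum_univ_succ, hu0 (Fin.last _), sub_self] at h1
  rw [Fin.sum_univ_succ, hv0 (Fin.last _), sub_self] at h2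
  simp only [Fin.cons_zero, Fin.cons_succ] at h1 h2
  refine ⟨hu0, hv0, fun j => hu0 j.succ ▸ s.mem_f j, fun j => hv0 j.succ ▸ s.mem_g j, ?_, ?_⟩
  · exact neg_eq_of_add_eq_zero_right h1
  · rw [← neg_neg (C (u 0))]
    exact neg_eq_of_add_eq_zero_right h2

variable {C : H₁ →L[ℝ] H₂} {f : Fin (m + 1) → H₁ → EReal} {g : Fin (m + 1) → H₂ → EReal}
  {u : H₁} {v : H₂} {b : Fin (m + 1) → H₁} {w : Fin (m + 1) → H₂}

theorem IsKKTPoint.primal_growth (h : IsKKTPoint C f g u v b w) (hf : ∀ j x, f j x ≠ ⊥)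
    (hg : ∀ j x, g j x ≠ ⊥) {s : Fin (m + 1) → ℝ} (hs : ∀ j, SubgradientGrowth (s j) (f j)) :
    ∃ c : ℝ, primalObjective C f g u ≤ c ∧
      ∀ y, ((c + (∑ j, s j) / 2 * ‖y - u‖ ^ 2 : ℝ) : EReal) ≤ primalObjective C f g y := by
  choose φ hφ hφ' using fun j => (mem_subdifferential_iff (hf j)).1 (h.mem_f j)
  choose ψ hψ hψ' using fun j => (mem_subdifferential_iff (hg j)).1 (h.mem_g j)
  refine ⟨∑ j, φ j + ∑ j, ψ j, ?_, fun y => ?_⟩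
  · rw [EReal.coe_add, ← sum_eq_coe hφ, ← sum_eq_coe hψ]
    exact add_le_add le_rfl (infConv_le g h.sum_w)
  · have h1 : ((∑ j, φ j + ⟪y - u, -(ContinuousLinearMap.adjoint C v)⟫_ℝ
        + (∑ j, s j) / 2 * ‖y - u‖ ^ 2 : ℝ) : EReal) ≤ ∑ j, f j y := by
      rw [h.sum_b, inner_sum, Finset.sum_div, Finset.sum_mul, ← Finset.sum_add_distrib,
        ← Finset.sum_add_distrib]
      exact coe_sum_le fun j => hs j (h.mem_f j) (hφ j) y
    have h2 : ((∑ j, ψ j + ⟪C y - C u, v⟫_ℝ : ℝ) : EReal) ≤ infConv g (C y) := by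
      refine le_infConv fun w' hw' => ?_
      rw [hw', h.sum_w, ← Finset.sum_sub_distrib, sum_inner, ← Finset.sum_add_distrib]
      exact coe_sum_le fun j => hψ' j (w' j)
    refine le_trans (le_of_eq ?_) (add_le_add h1 h2)
    rw [← EReal.coe_add, inner_neg_right, ContinuousLinearMap.adjoint_inner_right, map_sub]
    congr 1
    ring

theorem IsKKTPoint.dual_growth (h : IsKKTPoint C f g u v b w) (hf : ∀ j, Proper (f j))
    (hg : ∀ j, Proper (g j)) {s : Fin (m + 1) → ℝ}
    (hs : ∀ j, SubgradientGrowth (s j) (conj (g j))) :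
    ∃ c : ℝ, dualObjective C f g v ≤ c ∧
      ∀ y, ((c + (∑ j, s j) / 2 * ‖y - v‖ ^ 2 : ℝ) : EReal) ≤ dualObjective C f g y := by
  have hmf := fun j => mem_subdifferential_conj (hf j) (h.mem_f j)
  have hmg := fun j => mem_subdifferential_conj (hg j) (h.mem_g j)
  choose φ hφ hφ' using fun j => (mem_subdifferential_iff (conj_ne_bot (hf j))).1 (hmf j)
  choose ψ hψ hψ' using fun j => (mem_subdifferential_iff (conj_ne_bot (hg j))).1 (hmg j)
  refine ⟨∑ j, φ j + ∑ j, ψ j, ?_, fun y => ?_⟩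
  · rw [EReal.coe_add, ← sum_eq_coe hφ, ← sum_eq_coe hψ]
    exact add_le_add (infConv_le _ h.sum_b) le_rfl
  · have h1 : ((∑ j, φ j + ⟪-(ContinuousLinearMap.adjoint C y)
        - -(ContinuousLinearMap.adjoint C v), u⟫_ℝ : ℝ) : EReal)
        ≤ infConv (fun j => conj (f j)) (-(ContinuousLinearMap.adjoint C y)) := by
      refine le_infConv fun b' hb' => ?_
      rw [hb', h.sum_b, ← Finset.sum_sub_distrib, sum_inner, ← Finset.sum_add_distrib]
      exact coe_sum_le fun j => hφ' j (b' j)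
    have h2 : ((∑ j, ψ j + ⟪y - v, C u⟫_ℝ + (∑ j, s j) / 2 * ‖y - v‖ ^ 2 : ℝ) : EReal)
        ≤ ∑ j, conj (g j) y := by
      rw [h.sum_w, inner_sum, Finset.sum_div, Finset.sum_mul, ← Finset.sum_add_distrib,
        ← Finset.sum_add_distrib]
      exact coe_sum_le fun j => hs j (hmg j) (hψ j) y
    refine le_trans (le_of_eq ?_) (add_le_add h1 h2)
    rw [← EReal.coe_add, neg_sub_neg, ← map_sub, ContinuousLinearMap.adjoint_inner_left,
      ← neg_sub y v, inner_neg_left]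
    congr 1
    ring

/-- The primal-dual gap lies between zero and a bilinear expression in the differences of the
points and of the subgradients. -/
theorem IsKKTPoint.exists_gap_eq (h : IsKKTPoint C f g u v b w) (hf : ∀ j, Proper (f j))
    (hg : ∀ j, Proper (g j)) {u' : H₁} {v' : H₂} {b' : Fin (m + 1) → H₁} {w' : Fin (m + 1) → H₂}
    (hb' : ∀ j, b' j ∈ subdifferential (f j) u') (hw' : ∀ j, v' ∈ subdifferential (g j) (w' j)) :
    ∃ G : ℝ, gap C f g u v u' v' = G ∧ 0 ≤ G ∧
      G ≤ ∑ j, (⟪u' - u, b' j - b j⟫_ℝ + ⟪v' - v, w' j - w j⟫_ℝ) := by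
  have hmg := fun j => mem_subdifferential_conj (hg j) (h.mem_g j)
  have hmg' := fun j => mem_subdifferential_conj (hg j) (hw' j)
  choose φ hφ hφs using fun j => (mem_subdifferential_iff (hf j).1).1 (h.mem_f j)
  choose φ' hφ' hφs' using fun j => (mem_subdifferential_iff (hf j).1).1 (hb' j)
  choose ψ hψ hψs using fun j => (mem_subdifferential_iff (conj_ne_bot (hg j))).1 (hmg j)
  choose ψ' hψ' hψs' using fun j => (mem_subdifferential_iff (conj_ne_bot (hg j))).1 (hmg' j)
  have hsb : ∑ j, ⟪u' - u, b j⟫_ℝ = -⟪C u' - C u, v⟫_ℝ := by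
    rw [← inner_sum, ← h.sum_b, inner_neg_right, ContinuousLinearMap.adjoint_inner_right, map_sub]
  have hsw : ∑ j, ⟪v' - v, w j⟫_ℝ = ⟪C u, v' - v⟫_ℝ := by
    rw [← inner_sum, ← h.sum_w, real_inner_comm]
  have hlow : ∑ j, (φ j + ⟪u' - u, b j⟫_ℝ + (ψ j + ⟪v' - v, w j⟫_ℝ)) ≤ ∑ j, (φ' j + ψ' j) := by
    refine Finset.sum_le_sum fun j _ => add_le_add ?_ ?_
    · exact EReal.coe_le_coe_iff.1 ((hφs j u').trans_eq (hφ' j))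
    · exact EReal.coe_le_coe_iff.1 ((hψs j v').trans_eq (hψ' j))
  have hup : ∑ j, (φ' j + ⟪u - u', b' j⟫_ℝ + (ψ' j + ⟪v - v', w' j⟫_ℝ)) ≤ ∑ j, (φ j + ψ j) := by
    refine Finset.sum_le_sum fun j _ => add_le_add ?_ ?_
    · exact EReal.coe_le_coe_iff.1 ((hφs' j u).trans_eq (hφ j))
    · exact EReal.coe_le_coe_iff.1 ((hψs' j v).trans_eq (hψ j))
  rw [← neg_sub u' u, ← neg_sub v' v] at hup
  simp only [inner_neg_left, Finset.sum_add_distrib, Finset.sum_neg_distrib, hsb, hsw,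
    inner_sub_right, Finset.sum_sub_distrib] at hlow hup ⊢
  refine ⟨(∑ j, φ' j + ⟪C u', v⟫_ℝ - ∑ j, ψ j) - (∑ j, φ j + ⟪C u, v'⟫_ℝ - ∑ j, ψ' j), ?_, ?_, ?_⟩
  · rw [gap, sum_eq_coe hφ, sum_eq_coe hφ', sum_eq_coe hψ, sum_eq_coe hψ']
    norm_cast
  · rw [inner_sub_left] at hlow
    linarith
  · rw [inner_sub_left (C u')]
    linarith

end Optimality

/-! ### Fixed points and linear convergence -/

section Convergence

theorem ConvergesRLinearly.of_norm_le {E F : Type*} [NormedAddCommGroup E] [NormedAddCommGroup F]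
    {z : ℕ → E} {zstar : E} (h : ConvergesRLinearly z zstar) {y : ℕ → F} {ystar : F} {K : ℝ}
    (hK : 0 ≤ K) (hy : ∀ k, ‖y k - ystar‖ ≤ K * ‖z k - zstar‖) : ConvergesRLinearly y ystar := by
  obtain ⟨c, r, hc, hr, hr1, hz⟩ := h
  refine ⟨K * c, r, by positivity, hr, hr1, fun k => (hy k).trans ?_⟩
  rw [mul_assoc]
  exact mul_le_mul_of_nonneg_left (hz k) hK

theorem ConvergesRLinearly.exists_norm_le {E : Type*} [NormedAddCommGroup E]
    {z : ℕ → E} {zstar : E} (h : ConvergesRLinearly z zstar) :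
    ∃ B : ℝ, 0 ≤ B ∧ ∀ k, ‖z k - zstar‖ ≤ B := by
  obtain ⟨c, r, hc, hr, hr1, hz⟩ := h
  exact ⟨c, hc, fun k => (hz k).trans (mul_le_of_le_one_right hc (pow_le_one₀ hr hr1.le))⟩

theorem convergesRLinearly_of_contraction {E : Type*} [NormedAddCommGroup E] {z : ℕ → E}
    {zstar : E} {ρ : ℝ} (hρ₀ : 0 ≤ ρ) (hρ₁ : ρ < 1)
    (h : ∀ k, ‖z (k + 1) - zstar‖ ≤ ρ * ‖z k - zstar‖) : ConvergesRLinearly z zstar := by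
  refine ⟨‖z 0 - zstar‖, ρ, norm_nonneg _, hρ₀, hρ₁, fun k => ?_⟩
  induction k with
  | zero => simp
  | succ k ih =>
    refine (h k).trans ((mul_le_mul_of_nonneg_left ih hρ₀).trans_eq ?_)
    ring

theorem norm_toLp_le_of_forall_norm_le {E ι : Type*} [NormedAddCommGroup E] [Fintype ι]
    {x : ι → E} {B : ℝ} (hB : 0 ≤ B) (hx : ∀ i, ‖x i‖ ≤ B) :
    ‖WithLp.toLp 2 x‖ ≤ Real.sqrt (Fintype.card ι) * B := by
  rw [PiLp.norm_eq_of_L2]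
  refine (Real.sqrt_le_sqrt (Finset.sum_le_sum fun i _ =>
    pow_le_pow_left₀ (norm_nonneg _) (hx i) 2)).trans_eq ?_
  rw [Finset.sum_const, nsmul_eq_mul, Real.sqrt_mul (Nat.cast_nonneg _), Real.sqrt_sq hB,
    Finset.card_univ]

variable {H₁ H₂ : Type*}
  [NormedAddCommGroup H₁] [InnerProductSpace ℝ H₁] [CompleteSpace H₁]
  [NormedAddCommGroup H₂] [InnerProductSpace ℝ H₂] [CompleteSpace H₂]
  {m : ℕ} {α β : ℝ≥0} {σ τ : ℝ} {f : Fin (m + 1) → H₁ → EReal} {g : Fin (m + 1) → H₂ → EReal}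

/-- The fixed point operator is a contraction for the Hilbert norm, hence has exactly one fixed
point. -/
theorem StandingAssumption.exists_unique_fixedPoint (hσ : 0 < σ) (hτ : 0 < τ)
    (h : StandingAssumption α β σ τ f g) {γ : ℝ} (hγ₀ : 0 < γ) (hγ₁ : γ < 1) (C : H₁ →L[ℝ] H₂) :
    ∃ (pstar : Fin (m + 1) → H₁) (qstar : Fin (m + 1) → H₂),
      ∀ pq : (Fin (m + 1) → H₁) × (Fin (m + 1) → H₂),
        Function.IsFixedPt (fixedPointOperator γ C f g) pq ↔ pq = (pstar, qstar) := by
  obtain ⟨ρ, K, hρ₀, hρ₁, -, H⟩ := h.exists_contraction hσ hτ hγ₀ hγ₁ C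
  set T := fixedPointOperator γ C f g
  set S : WithLp 2 (WithLp 2 (Fin (m + 1) → H₁) × WithLp 2 (Fin (m + 1) → H₂)) →
      WithLp 2 (WithLp 2 (Fin (m + 1) → H₁) × WithLp 2 (Fin (m + 1) → H₂)) :=
    fun z => toPair (T (z.fst.ofLp, z.snd.ofLp)).1 (T (z.fst.ofLp, z.snd.ofLp)).2
  have hS : ContractingWith ⟨ρ, hρ₀⟩ S := by
    refine ⟨hρ₁, LipschitzWith.of_dist_le_mul fun z z' => ?_⟩
    obtain ⟨u, v, b, w, s, hT⟩ := exists_isPrimalDualStep_fixedPointOperator hσ hτ h γ C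
      (z.fst.ofLp, z.snd.ofLp)
    obtain ⟨u', v', b', w', s', hT'⟩ := exists_isPrimalDualStep_fixedPointOperator hσ hτ h γ C
      (z'.fst.ofLp, z'.snd.ofLp)
    have hc := (H s s').1
    rw [dist_eq_norm, dist_eq_norm]
    simp only [S, T]
    rw [hT, hT']
    exact hc
  have hfix : ∀ pq : (Fin (m + 1) → H₁) × (Fin (m + 1) → H₂),
      Function.IsFixedPt T pq ↔ Function.IsFixedPt S (toPair pq.1 pq.2) := by
    intro pq
    refine ⟨fun h1 => ?_, fun h1 => ?_⟩
    · change toPair (T pq).1 (T pq).2 = toPair pq.1 pq.2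
      rw [h1.eq]
    · have h2 : toPair (T pq).1 (T pq).2 = toPair pq.1 pq.2 := h1
      exact Prod.ext (congrArg (fun z => z.fst.ofLp) h2) (congrArg (fun z => z.snd.ofLp) h2)
  set zstar := ContractingWith.fixedPoint S hS
  refine ⟨zstar.fst.ofLp, zstar.snd.ofLp, fun pq => ?_⟩
  rw [hfix]
  constructor
  · intro h1
    have h2 : toPair pq.1 pq.2 = zstar := hS.fixedPoint_unique h1
    rw [← h2]
    rfl
  · rintro rfl
    exact hS.fixedPoint_isFixedPt

theorem StandingAssumption.exists_modulus_f (hσ : 0 < σ) (h : StandingAssumption α β σ τ f g) :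
    ∃ s : Fin (m + 1) → ℝ, 0 < ∑ j, s j ∧ ∀ j, SubgradientGrowth (s j) (f j) := by
  refine ⟨Fin.snoc (α := fun _ => ℝ) (fun _ : Fin m => 0) σ, ?_, fun j => ?_⟩
  · simpa [Fin.sum_univ_castSucc] using hσ
  · induction j using Fin.lastCases with
    | last => simpa using h.f_last.isClosedConvex.subgradientGrowth
    | cast i => simpa using (h.isClosedConvex_f hσ i.castSucc).subgradientGrowth

theorem StandingAssumption.exists_modulus_conj_g (hτ : 0 < τ)
    (h : StandingAssumption α β σ τ f g) :
    ∃ s : Fin (m + 1) → ℝ, 0 < ∑ j, s j ∧ ∀ j, SubgradientGrowth (s j) (conj (g j)) := by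
  have hβ : (0 : ℝ) ≤ β := β.2
  refine ⟨Fin.snoc (α := fun _ => ℝ) (fun _ : Fin m => 0) (1 / (2 * ((β : ℝ) + 1))), ?_,
    fun j => ?_⟩
  · simp only [Fin.sum_univ_castSucc, Fin.snoc_castSucc, Fin.snoc_last, Finset.sum_const_zero,
      zero_add]
    positivity
  · induction j using Fin.lastCases with
    | last =>
      rw [Fin.snoc_last]
      exact h.g_last.subgradientGrowth_conj
    | cast i =>
      rw [Fin.snoc_castSucc]
      intro v w c hw hc y
      obtain ⟨c', hc', h1⟩ := (mem_subdifferential_iff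
        (conj_ne_bot (h.isClosedConvex_g hτ i.castSucc).proper)).1 hw
      obtain rfl : c = c' := by exact_mod_cast hc.symm.trans hc'
      rw [zero_div, zero_mul, add_zero]
      exact h1 y

/-- Near an optimal pair, subgradients at a common point `(u, v)` of all the functions are close
to the ones at the optimal pair, once this is known for the two functions `f_n` and `g_n*`: the
others have Lipschitz continuous gradients. -/
theorem StandingAssumption.exists_subgradients (hτ : 0 < τ)
    (h : StandingAssumption α β σ τ f g) {C : H₁ →L[ℝ] H₂} {ustar : H₁} {vstar : H₂} {b w}
    (hkkt : IsKKTPoint C f g ustar vstar b w) {u b₀ : H₁} {v w₀ : H₂}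
    (hb₀ : b₀ ∈ subdifferential (f (Fin.last m)) u)
    (hw₀ : v ∈ subdifferential (g (Fin.last m)) w₀) :
    ∃ (b' : Fin (m + 1) → H₁) (w' : Fin (m + 1) → H₂),
      (∀ j, b' j ∈ subdifferential (f j) u) ∧ (∀ j, v ∈ subdifferential (g j) (w' j)) ∧
      (∀ j, ‖b' j - b j‖ ≤ α * ‖u - ustar‖ + ‖b₀ - b (Fin.last m)‖) ∧
      ∀ j, ‖w' j - w j‖ ≤ τ⁻¹ * ‖v - vstar‖ + ‖w₀ - w (Fin.last m)‖ := by
  have hα : 0 ≤ α * ‖u - ustar‖ := mul_nonneg α.2 (norm_nonneg _)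
  have hτ' : 0 ≤ τ⁻¹ * ‖v - vstar‖ := by positivity
  have hex : ∀ j : Fin (m + 1), ∃ (b' : H₁) (w' : H₂), b' ∈ subdifferential (f j) u ∧
      v ∈ subdifferential (g j) w' ∧ ‖b' - b j‖ ≤ α * ‖u - ustar‖ + ‖b₀ - b (Fin.last m)‖ ∧
      ‖w' - w j‖ ≤ τ⁻¹ * ‖v - vstar‖ + ‖w₀ - w (Fin.last m)‖ := by
    intro j
    induction j using Fin.lastCases with
    | last => exact ⟨b₀, w₀, hb₀, hw₀, le_add_of_nonneg_left hα, le_add_of_nonneg_left hτ'⟩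
    | cast i =>
      have hg := (h.g_strong i).isClosedConvex
      obtain ⟨w', hw'⟩ := hg.exists_mem_subdifferential hτ v
      refine ⟨grad (f i.castSucc) u, w', (h.f_smooth i).grad_mem_subdifferential u, hw',
        le_add_of_le_of_nonneg ?_ (norm_nonneg _), le_add_of_le_of_nonneg ?_ (norm_nonneg _)⟩
      · rw [(h.f_smooth i).eq_grad (hkkt.mem_f i.castSucc)]
        exact (h.f_smooth i).norm_grad_sub_le _ _
      · exact hg.norm_sub_le_of_mem_subdifferential hτ hw' (hkkt.mem_g i.castSucc)
  choose b' w' h1 h2 h3 h4 using hex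
  exact ⟨b', w', h1, h2, h3, h4⟩

end Convergence

end PrimalDual

theorem corollary4p3
    {H₁ : Type*} [NormedAddCommGroup H₁] [InnerProductSpace ℝ H₁] [CompleteSpace H₁]
    {H₂ : Type*} [NormedAddCommGroup H₂] [InnerProductSpace ℝ H₂] [CompleteSpace H₂]
    (m : ℕ) (C : H₁ →L[ℝ] H₂)
    (f : Fin (m + 1) → H₁ → EReal) (g : Fin (m + 1) → H₂ → EReal)
    (α β : ℝ≥0) (σ τ : ℝ) (hσ : 0 < σ) (hτ : 0 < τ)
    (hfg : PrimalDual.StandingAssumption α β σ τ f g)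
    (γ : ℝ) (hγ₀ : 0 < γ) (hγ₁ : γ < 1)
    (p : ℕ → Fin (m + 1) → H₁) (q : ℕ → Fin (m + 1) → H₂)
    (u : ℕ → Fin (m + 2) → H₁) (v : ℕ → Fin (m + 2) → H₂)
    (hgen : PrimalDual.IsGenerated γ C f g p q u v) :
    (∃ (pstar : Fin (m + 1) → H₁) (qstar : Fin (m + 1) → H₂),
      (∀ pq : (Fin (m + 1) → H₁) × (Fin (m + 1) → H₂),
        Function.IsFixedPt (PrimalDual.fixedPointOperator γ C f g) pq ↔ pq = (pstar, qstar)) ∧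
      PrimalDual.ConvergesRLinearly
        (fun k => WithLp.toLp 2 (WithLp.toLp 2 (p k), WithLp.toLp 2 (q k)))
        (WithLp.toLp 2 (WithLp.toLp 2 pstar, WithLp.toLp 2 qstar))) ∧
    ∃ (ustar : H₁) (vstar : H₂),
      (∀ w, PrimalDual.IsSolution (PrimalDual.primalObjective C f g) w ↔ w = ustar) ∧
      (∀ w, PrimalDual.IsSolution (PrimalDual.dualObjective C f g) w ↔ w = vstar) ∧
      PrimalDual.ConvergesRLinearly
        (fun k => WithLp.toLp 2 (u k)) (WithLp.toLp 2 fun _ => ustar) ∧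
      PrimalDual.ConvergesRLinearly
        (fun k => WithLp.toLp 2 (v k)) (WithLp.toLp 2 fun _ => vstar) ∧
      ∃ G : ℕ → ℝ,
        (∀ k, PrimalDual.gap C f g ustar vstar
          (u k (Fin.last (m + 1))) (v k (Fin.last (m + 1))) = (G k : EReal)) ∧
        PrimalDual.ConvergesRLinearly G 0 := by
  obtain ⟨pstar, qstar, hfix⟩ := hfg.exists_unique_fixedPoint hσ hτ hγ₀ hγ₁ C
  obtain ⟨ρ, K, hρ₀, hρ₁, hK, H⟩ := hfg.exists_contraction hσ hτ hγ₀ hγ₁ C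
  obtain ⟨us, vs, b, w, s, hT⟩ := PrimalDual.exists_isPrimalDualStep_fixedPointOperator
    hσ hτ hfg γ C (pstar, qstar)
  rw [((hfix _).2 rfl).eq, Prod.ext_iff] at hT
  have hp := hT.1
  have hq := hT.2
  simp only at hp hq s
  have hu : ∀ i : Fin (m + 1), us i.succ = us i.castSucc := fun i => by
    simpa [hγ₀.ne', sub_eq_zero] using congrFun hp i
  have hv : ∀ i : Fin (m + 1), vs i.succ = vs i.castSucc := fun i => by
    simpa [hγ₀.ne', sub_eq_zero] using congrFun hq i
  obtain ⟨hus, hvs, hkkt⟩ := s.isKKTPoint hu hv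
  have hstep := hgen.isPrimalDualStep hσ hτ hfg
  have hconv : PrimalDual.ConvergesRLinearly (fun k => PrimalDual.toPair (p k) (q k))
      (PrimalDual.toPair pstar qstar) := by
    refine PrimalDual.convergesRLinearly_of_contraction hρ₀ hρ₁ fun k => ?_
    have h1 := (H (hstep k) s).1
    rw [← hp, ← hq] at h1
    rw [funext (hgen.p_update k), funext (hgen.q_update k)]
    exact h1
  have hpf := fun j => (hfg.isClosedConvex_f hσ j).proper
  have hpg := fun j => (hfg.isClosedConvex_g hτ j).proper
  refine ⟨⟨pstar, qstar, hfix, hconv⟩, us 0, vs 0, ?_, ?_, ?_, ?_, ?_⟩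
  · obtain ⟨t, ht, hts⟩ := hfg.exists_modulus_f hσ
    obtain ⟨c, hc, hg⟩ := hkkt.primal_growth (fun j => (hpf j).1) (fun j => (hpg j).1) hts
    exact PrimalDual.isSolution_iff_of_growth (half_pos ht) hc hg
  · obtain ⟨t, ht, hts⟩ := hfg.exists_modulus_conj_g hτ
    obtain ⟨c, hc, hg⟩ := hkkt.dual_growth hpf hpg hts
    exact PrimalDual.isSolution_iff_of_growth (half_pos ht) hc hg
  · refine hconv.of_norm_le (K := Real.sqrt (Fintype.card (Fin (m + 2))) * K) (by positivity)
      fun k => ?_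
    rw [mul_assoc, ← WithLp.toLp_sub]
    exact PrimalDual.norm_toLp_le_of_forall_norm_le (by positivity) fun i =>
      hus i ▸ ((H (hstep k) s).2.1 i).1
  · refine hconv.of_norm_le (K := Real.sqrt (Fintype.card (Fin (m + 2))) * K) (by positivity)
      fun k => ?_
    rw [mul_assoc, ← WithLp.toLp_sub]
    exact PrimalDual.norm_toLp_le_of_forall_norm_le (by positivity) fun i =>
      hvs i ▸ ((H (hstep k) s).2.1 i).2
  · have hα : (0 : ℝ) ≤ α := α.2
    obtain ⟨B, hB₀, hB⟩ := hconv.exists_norm_le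
    set M : ℝ := (α + τ⁻¹ + 1) * K with hM
    have hM₀ : 0 ≤ M := by positivity
    have hgap : ∀ k, ∃ G : ℝ, PrimalDual.gap C f g (us 0) (vs 0) (u k (Fin.last (m + 1)))
        (v k (Fin.last (m + 1))) = (G : EReal) ∧
        ‖G - 0‖ ≤ (m + 1) * (2 * (K * M * B)) *
          ‖PrimalDual.toPair (p k) (q k) - PrimalDual.toPair pstar qstar‖ := by
      intro k
      obtain ⟨-, h1, h2⟩ := H (hstep k) s
      set e := ‖PrimalDual.toPair (p k) (q k) - PrimalDual.toPair pstar qstar‖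
      have he : 0 ≤ e := norm_nonneg _
      have hKe : 0 ≤ K * e := by positivity
      have hu₁ := (h1 (Fin.last (m + 1))).1
      have hv₁ := (h1 (Fin.last (m + 1))).2
      rw [hus (Fin.last (m + 1))] at hu₁
      rw [hvs (Fin.last (m + 1))] at hv₁
      obtain ⟨b', w', hb', hw', hbb, hww⟩ := hfg.exists_subgradients hτ hkkt
        ((hstep k).mem_f (Fin.last m)) ((hstep k).mem_g (Fin.last m))
      rw [Fin.succ_last] at hb' hw' hbb hww
      obtain ⟨G, hG, hG₀, hGle⟩ := hkkt.exists_gap_eq hpf hpg hb' hw'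
      refine ⟨G, hG, ?_⟩
      rw [sub_zero, Real.norm_of_nonneg hG₀]
      have hτ₀ : 0 ≤ τ⁻¹ := by positivity
      -- Each summand is a product of two factors of the order of the error `e`.
      have hterm : ∀ j, ⟪u k (Fin.last (m + 1)) - us 0, b' j - b j⟫_ℝ
          + ⟪v k (Fin.last (m + 1)) - vs 0, w' j - w j⟫_ℝ ≤ 2 * (K * M * B) * e := by
        intro j
        have hbj : ‖b' j - b j‖ ≤ M * e := by
          have h3 := mul_le_mul_of_nonneg_left hu₁ hα
          have h4 := (h2 (Fin.last m)).1
          have h5 := mul_nonneg hτ₀ hKe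
          refine ((hbb j).trans (add_le_add h3 h4)).trans ?_
          rw [hM]
          linarith
        have hwj : ‖w' j - w j‖ ≤ M * e := by
          have h3 := mul_le_mul_of_nonneg_left hv₁ hτ₀
          have h4 := (h2 (Fin.last m)).2
          have h5 := mul_nonneg hα hKe
          refine ((hww j).trans (add_le_add h3 h4)).trans ?_
          rw [hM]
          linarith
        have h3 := (real_inner_le_norm _ _).trans (mul_le_mul hu₁ hbj (norm_nonneg _) hKe)
        have h4 := (real_inner_le_norm _ _).trans (mul_le_mul hv₁ hwj (norm_nonneg _) hKe)
        have h5 : K * M * e * e ≤ K * M * e * B :=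
          mul_le_mul_of_nonneg_left (hB k) (by positivity)
        linarith
      refine hGle.trans ((Finset.sum_le_sum fun j _ => hterm j).trans_eq ?_)
      rw [Finset.sum_const, Finset.card_univ, Fintype.card_fin, nsmul_eq_mul]
      push_cast
      ring
    choose G hG hGle using hgap
    exact ⟨G, hG, hconv.of_norm_le (by positivity) hGle⟩
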